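/- **Conventions.** A monoid $H$ is a commutative multiplicative semigroup with identity and more than one element in which every nonzero element is cancellative; here $z(H)=\{z\in H\mid zx=z\text{ for all }x\in H\}$ is the set of zero elements (it has at most one element, and may be empty), and an element is nonzero if it is not in $z(H)$. Let $G$ be the quotient monoid of $H$ (the localization at the nonzero elements). For $X\subseteq H$, $Y\subseteq G$ put $\sqrt X=\{x\in H\mid x^n\in X\text{ for some }n\ge 1\}$ and $Y^{-1}=\{g\in G\mid gY\subseteq H\}$; $X$ is radical if $\sqrt X=X$. A principal ideal is a set $AH\cup z(H)$ with $A\subseteq H$, $|A|\le 1$; it is nontrivial if it properly contains $z(H)$. For $X\subseteq H$ let $X_s=XH\cup z(H)$. If $H\neq G$ let $X_v=(X^{-1})^{-1}$; if $H=G$ let $X_v=z(H)$ for $X\subseteq z(H)$ and $X_v=H$ otherwise. Let $X_t=\bigcup_{E\subseteq X,\,|E|<\infty}E_v$ and $X_w=\{x\in H\mid xF\subseteq X_s\text{ and }F_t=H\text{ for some }F\subseteq H\}$. Let $r\in\{s,t,w\}$. A set $I\subseteq H$ is an $r$-ideal if $I_r=I$; it is $r$-invertible if moreover $(II^{-1})_r=H$,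 and $r$-finitely generated if $I=E_r$ for some finite $E\subseteq I$. The $r$-product of $I_1,\dots,I_n$ is $(I_1\cdots I_n)_r$. The $r$-maximal $r$-ideals are the maximal elements of the set of $r$-ideals different from $H$; these are prime. $H$ is an $r$-SP-monoid if every $r$-ideal is a finite $r$-product of radical $r$-ideals. $H$ is an $r$-finite conductor monoid if $xH\cap yH$ is $r$-finitely generated for all $x,y\in H$. A monoid is a DVM if it differs from its quotient monoid and all its $s$-ideals are principal. $H$ is an $r$-almost Dedekind monoid if $H=G$ or the localization $H_M=(H\setminus M)^{-1}H$ is a DVM for every $r$-maximal $r$-ideal $M$. **Corollary 4.4.** Let $H$ be a monoid. The following are equivalent: 1. $H$ is a $t$-almost Dedekind $t$-SP-monoid. 2. $H$ is a $w$-SP-monoid. 3. $H$ is a $w$-finite conductor monoid and every principal ideal of $H$ is a finite $w$-product of radical $w$-ideals of $H$. 4. Every $w$-ideal of $H$ is a $w$-product of finitely many pairwise comparable radical $w$-ideals of $H$. 5. The radical of every nontrivial principal ideal of $H$ is $w$-invertible. Moreover, $H$ is a $w$-SP-monoid if and only if the radical of every nontrivial principal ideal of $H$ is $t$-invertible. 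-/

import Mathlib

open scoped Pointwise

namespace IdealSys

/-- The set `z(H)` of zero elements of `H`; it has at most one element. -/
def zeroSet (H : Type*) [CommMonoid H] : Set H := {z | ∀ x, z * x = z}

/-- The standing convention on monoids: a commutative semigroup with identity and more than
one element in which every nonzero element is cancellative (a zero element may or may not exist). -/
class IsNonzeroCancel (H : Type*) [CommMonoid H] : Prop extends Nontrivial H where
  cancel : ∀ a : H, a ∉ zeroSet H → ∀ b c : H, a * b = a * c → b = c

section Basic

variable {H : Type*} [CommMonoid H]

theorem zero_unique {a b : H} (ha : a ∈ zeroSet H) (hb : b ∈ zeroSet H) : a = b := by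
  rw [← ha b, mul_comm, hb a]

theorem zero_mul_mem {a : H} (ha : a ∈ zeroSet H) (b : H) : a * b ∈ zeroSet H := by
  rw [ha b]; exact ha

variable [IsNonzeroCancel H]

theorem one_notMem_zeroSet : (1 : H) ∉ zeroSet H := by
  intro h
  obtain ⟨a, b, hab⟩ := exists_pair_ne H
  exact hab (by rw [← one_mul a, ← one_mul b, h a, h b])

theorem mul_notMem_zeroSet {a b : H} (ha : a ∉ zeroSet H) (hb : b ∉ zeroSet H) :
    a * b ∉ zeroSet H := by
  intro h
  apply hb
  have hx : b = a * b := IsNonzeroCancel.cancel a ha _ _ (by rw [mul_comm a (a * b), h a])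
  rw [hx]; exact h

end Basic

/-- The submonoid of nonzero elements of `H`. -/
def nonzero (H : Type*) [CommMonoid H] [IsNonzeroCancel H] : Submonoid H where
  carrier := {a | a ∉ zeroSet H}
  one_mem' := one_notMem_zeroSet
  mul_mem' := mul_notMem_zeroSet

/-- The quotient monoid `G` of `H`. -/
abbrev QuotMonoid (H : Type*) [CommMonoid H] [IsNonzeroCancel H] : Type _ := Localization (nonzero H)

/-- The canonical embedding `H → G`. -/
def incl (H : Type*) [CommMonoid H] [IsNonzeroCancel H] : H →* QuotMonoid H :=
  (Localization.monoidOf (nonzero H)).toMonoidHom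

/-- `H = G`. -/
def EqQuot (H : Type*) [CommMonoid H] [IsNonzeroCancel H] : Prop := Function.Surjective (incl H)

/-- `Y⁻¹ = {z ∈ G | zY ⊆ H}`. -/
def invSet {H : Type*} [CommMonoid H] [IsNonzeroCancel H] (Y : Set (QuotMonoid H)) :
    Set (QuotMonoid H) :=
  {z | ∀ y ∈ Y, z * y ∈ Set.range (incl H)}

/-- `√X`. -/
def rad {H : Type*} [CommMonoid H] (X : Set H) : Set H := {x | ∃ n : ℕ, 0 < n ∧ x ^ n ∈ X}

/-- A finitary ideal system on `H`. -/
structure FinIdealSystem (H : Type*) [CommMonoid H] where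
  cl : Set H → Set H
  sub_cl : ∀ X, X * Set.univ ∪ zeroSet H ⊆ cl X
  cl_sub : ∀ X Y, X ⊆ cl Y → cl X ⊆ cl Y
  mul_cl : ∀ (c : H) (X : Set H), (fun x => c * x) '' cl X = cl ((fun x => c * x) '' X)
  finitary : ∀ X, cl X = ⋃ E ∈ {E : Set H | E ⊆ X ∧ E.Finite}, cl E

namespace FinIdealSystem

variable {H : Type*} [CommMonoid H] (r : FinIdealSystem H)

theorem subset_cl (X : Set H) : X ⊆ r.cl X := fun x hx =>
  r.sub_cl X (Or.inl ⟨x, hx, 1, trivial, mul_one x⟩)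

theorem mul_mem_cl {X : Set H} {x : H} (hx : x ∈ r.cl X) (y : H) : x * y ∈ r.cl X :=
  r.cl_sub (r.cl X) X subset_rfl (r.sub_cl _ (Or.inl ⟨x, hx, y, trivial, rfl⟩))

theorem cl_mono {X Y : Set H} (h : X ⊆ Y) : r.cl X ⊆ r.cl Y :=
  r.cl_sub _ _ (h.trans (r.subset_cl Y))

theorem cl_eq_univ {X : Set H} (h : (1 : H) ∈ r.cl X) : r.cl X = Set.univ :=
  Set.eq_univ_of_forall fun x => by simpa using r.mul_mem_cl h x

theorem mem_cl_iff {X : Set H} {x : H} :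
    x ∈ r.cl X ↔ ∃ E ⊆ X, E.Finite ∧ x ∈ r.cl E := by
  conv_lhs => rw [r.finitary X]
  simp [and_assoc]

theorem mul_mem_cl_image {X : Set H} {x : H} (c : H) (hx : x ∈ r.cl X) :
    c * x ∈ r.cl ((fun x => c * x) '' X) := by
  rw [← r.mul_cl]; exact ⟨x, hx, rfl⟩

theorem cl_mul_eq_univ {E F : Set H} (hE : r.cl E = Set.univ) (hF : r.cl F = Set.univ) :
    r.cl (E * F) = Set.univ := by
  have h : E ⊆ r.cl (E * F) := by
    intro e he
    have h1 := r.mul_mem_cl_image (X := F) (x := 1) e (hF ▸ trivial)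
    rw [mul_one] at h1
    refine r.cl_mono ?_ h1
    rintro _ ⟨f, hf, rfl⟩
    exact ⟨e, he, f, hf, rfl⟩
  exact r.cl_eq_univ (r.cl_sub _ _ h (hE ▸ trivial))

/-- `p ≤ r`. -/
def Finer (p r : FinIdealSystem H) : Prop := ∀ X, p.cl X ⊆ r.cl X

end FinIdealSystem

/-- The `s`-system `X ↦ XH ∪ z(H)`. -/
def sSystem (H : Type*) [CommMonoid H] : FinIdealSystem H where
  cl X := X * Set.univ ∪ zeroSet H
  sub_cl _ := subset_rfl
  cl_sub X Y h := by
    rintro _ (⟨x, hx, y, -, rfl⟩ | hx)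
    · rcases h hx with ⟨a, ha, b, -, rfl⟩ | hz
      · exact Or.inl ⟨a, ha, b * y, trivial, (mul_assoc _ _ _).symm⟩
      · exact Or.inr (zero_mul_mem hz y)
    · exact Or.inr hx
  mul_cl c X := by
    ext z
    constructor
    · rintro ⟨_, ⟨x, hx, y, -, rfl⟩ | hx, rfl⟩
      · exact Or.inl ⟨c * x, ⟨x, hx, rfl⟩, y, trivial, mul_assoc _ _ _⟩
      · exact Or.inr (by simpa only [mul_comm c] using zero_mul_mem hx c)
    · rintro (⟨_, ⟨x, hx, rfl⟩, y, -, rfl⟩ | hz)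
      · exact ⟨x * y, Or.inl ⟨x, hx, y, trivial, rfl⟩, (mul_assoc _ _ _).symm⟩
      · exact ⟨z, Or.inr hz, by simp only [mul_comm c, hz c]⟩
  finitary X := by
    ext z
    simp only [Set.mem_iUnion, Set.mem_ofPred_eq, exists_prop]
    constructor
    · rintro (⟨x, hx, y, -, rfl⟩ | hz)
      · exact ⟨{x}, ⟨by simpa using hx, Set.finite_singleton x⟩,
          Or.inl ⟨x, rfl, y, trivial, rfl⟩⟩
      · exact ⟨∅, ⟨Set.empty_subset _, Set.finite_empty⟩, Or.inr hz⟩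
    · rintro ⟨E, ⟨hE, -⟩, ⟨x, hx, y, -, rfl⟩ | hz⟩
      · exact Or.inl ⟨x, hE hx, y, trivial, rfl⟩
      · exact Or.inr hz

section Quotient

variable {H : Type*} [CommMonoid H] [IsNonzeroCancel H]

theorem incl_isUnit {a : H} (ha : a ∉ zeroSet H) : IsUnit (incl H a) :=
  (Localization.monoidOf (nonzero H)).map_units ⟨a, ha⟩

theorem incl_injective : Function.Injective (incl H) := by
  intro a b h
  obtain ⟨c, hc⟩ := (Localization.monoidOf (nonzero H)).exists_of_eq h
  exact IsNonzeroCancel.cancel (c : H) c.2 _ _ hc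

theorem exists_mul_incl (g : QuotMonoid H) : ∃ a s : H, s ∉ zeroSet H ∧ g * incl H s = incl H a := by
  obtain ⟨⟨a, s⟩, h⟩ := (Localization.monoidOf (nonzero H)).surj g
  exact ⟨a, s, s.2, h⟩

theorem mul_incl_zero {c : H} (hc : c ∈ zeroSet H) (g : QuotMonoid H) : g * incl H c = incl H c := by
  obtain ⟨a, s, -, h⟩ := exists_mul_incl g
  rw [← hc s, map_mul, mul_comm (incl H c), ← mul_assoc, h, ← map_mul, ← map_mul,
    mul_comm a, mul_comm s, hc, hc]

open Classical in
/-- The `v`-system: `X ↦ (X⁻¹)⁻¹` if `H ≠ G`; if `H = G`, then only `z(H)` and `H` are closed. -/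
noncomputable def vCl (X : Set H) : Set H :=
  if EqQuot H then (if X ⊆ zeroSet H then zeroSet H else Set.univ)
  else incl H ⁻¹' invSet (invSet (incl H '' X))

theorem mem_vCl_of_ne (h : ¬ EqQuot H) {X : Set H} {x : H} :
    x ∈ vCl X ↔ ∀ g : QuotMonoid H, (∀ y ∈ X, g * incl H y ∈ Set.range (incl H)) →
      incl H x * g ∈ Set.range (incl H) := by
  simp [vCl, h, invSet]

theorem vCl_sub {X Y : Set H} (hXY : X ⊆ vCl Y) : vCl X ⊆ vCl Y := by
  by_cases h : EqQuot H
  · by_cases hY : Y ⊆ zeroSet H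
    · have hX : X ⊆ zeroSet H := by simpa [vCl, h, hY] using hXY
      simp [vCl, h, hY, hX]
    · simp [vCl, h, hY]
  · intro x hx
    rw [mem_vCl_of_ne h] at hx ⊢
    intro g hg
    refine hx g fun y hy => ?_
    rw [mul_comm]
    exact (mem_vCl_of_ne h).1 (hXY hy) g hg

theorem sub_vCl (X : Set H) : X * Set.univ ∪ zeroSet H ⊆ vCl X := by
  by_cases h : EqQuot H
  · by_cases hX : X ⊆ zeroSet H
    · rintro _ (⟨x, hx, y, -, rfl⟩ | hx)
      · simpa [vCl, h, hX] using zero_mul_mem (hX hx) y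
      · simpa [vCl, h, hX] using hx
    · simp [vCl, h, hX]
  · rintro _ (⟨x, hx, y, -, rfl⟩ | hx) <;> rw [mem_vCl_of_ne h] <;> intro g hg
    · obtain ⟨a, ha⟩ := hg x hx
      exact ⟨a * y, by simp only [map_mul, ha]; ac_rfl⟩
    · exact ⟨_, by rw [mul_comm, mul_incl_zero hx]⟩

theorem vCl_zero {X : Set H} (hX : X ⊆ zeroSet H) : vCl X = zeroSet H := by
  by_cases h : EqQuot H
  · simp [vCl, h, hX]
  · refine Set.Subset.antisymm (fun x hx => ?_) (Set.subset_union_right.trans (sub_vCl X))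
    by_contra hx0
    apply h
    intro g
    obtain ⟨u, hu⟩ := (incl_isUnit hx0).exists_right_inv
    have := (mem_vCl_of_ne h).1 hx (u * g)
      (fun y hy => ⟨y, (mul_incl_zero (hX hy) _).symm⟩)
    rwa [← mul_assoc, hu, one_mul] at this

theorem mul_vCl (c : H) (X : Set H) :
    (fun x => c * x) '' vCl X = vCl ((fun x => c * x) '' X) := by
  by_cases hc : c ∈ zeroSet H
  · rw [vCl_zero (X := (fun x => c * x) '' X)
      (by rintro _ ⟨x, -, rfl⟩; exact zero_mul_mem hc x)]
    ext z
    constructor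
    · rintro ⟨x, -, rfl⟩; exact zero_mul_mem hc x
    · intro hz
      exact ⟨c, sub_vCl X (Or.inr hc), zero_unique (zero_mul_mem hc c) hz⟩
  · obtain ⟨u, hu⟩ := (incl_isUnit hc).exists_right_inv
    by_cases h : EqQuot H
    · by_cases hX : X ⊆ zeroSet H
      · rw [vCl_zero hX, vCl_zero (X := (fun x => c * x) '' X)
          (by rintro _ ⟨x, hx, rfl⟩; dsimp only; rw [mul_comm]; exact zero_mul_mem (hX hx) c)]
        ext z
        constructor
        · rintro ⟨x, hx, rfl⟩; dsimp only; rw [mul_comm]; exact zero_mul_mem hx c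
        · intro hz; exact ⟨z, hz, by dsimp only; rw [mul_comm, hz]⟩
      · have hX' : ¬ ((fun x => c * x) '' X ⊆ zeroSet H) := by
          intro hh
          obtain ⟨x, hx, hx0⟩ := Set.not_subset.1 hX
          exact mul_notMem_zeroSet hc hx0 (hh ⟨x, hx, rfl⟩)
        obtain ⟨d, hd⟩ := h u
        have hcd : c * d = 1 := incl_injective (by rw [map_mul, hd, hu, map_one])
        simp only [vCl, h, hX, hX', if_true, if_false]
        refine Set.eq_univ_of_forall fun x => ⟨d * x, trivial, ?_⟩
        simp only [← mul_assoc, hcd, one_mul]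
    · ext z
      constructor
      · rintro ⟨x, hx, rfl⟩
        rw [mem_vCl_of_ne h] at hx ⊢
        intro g hg
        have := hx (g * incl H c) (fun y hy => by
          have := hg _ ⟨y, hy, rfl⟩
          simpa only [map_mul, mul_assoc] using this)
        rw [map_mul]
        convert this using 1
        ac_rfl
      · intro hz
        rw [mem_vCl_of_ne h] at hz
        have key : ∀ y, u * incl H (c * y) = incl H y := by
          intro y
          rw [map_mul, ← mul_assoc, mul_comm u, hu, one_mul]
        obtain ⟨k, hk⟩ := hz u (by rintro _ ⟨y, -, rfl⟩; exact ⟨y, (key y).symm⟩)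
        refine ⟨k, ?_, incl_injective ?_⟩
        · rw [mem_vCl_of_ne h]
          intro g hg
          have := hz (u * g) (by
            rintro _ ⟨y, hy, rfl⟩
            rw [mul_comm u, mul_assoc, key]
            exact hg y hy)
          rwa [← mul_assoc, ← hk] at this
        · rw [map_mul, hk, mul_comm, mul_assoc, mul_comm u, hu, mul_one]

end Quotient

/-- The `t`-system `X ↦ ⋃ E_v`, over the finite subsets `E` of `X`. (If `H = G`, this is
`z(H)` for `X ⊆ z(H)` and `H` for all other `X`.) -/
noncomputable def tSystem (H : Type*) [CommMonoid H] [IsNonzeroCancel H] : FinIdealSystem H where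
  cl X := ⋃ E ∈ {E : Set H | E ⊆ X ∧ E.Finite}, vCl E
  sub_cl X := by
    rintro _ (⟨x, hx, y, -, rfl⟩ | hz)
    · exact Set.mem_biUnion (x := ({x} : Set H))
        ⟨by simpa using hx, Set.finite_singleton x⟩ (sub_vCl _ (Or.inl ⟨x, rfl, y, trivial, rfl⟩))
    · exact Set.mem_biUnion (x := (∅ : Set H)) ⟨Set.empty_subset _, Set.finite_empty⟩
        (sub_vCl _ (Or.inr hz))
  cl_sub X Y hXY := by
    intro x hx
    simp only [Set.mem_iUnion, Set.mem_ofPred_eq, exists_prop] at hx ⊢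
    obtain ⟨E, ⟨hE, hfin⟩, hx⟩ := hx
    have h1 : ∀ e ∈ E, ∃ F : Set H, (F ⊆ Y ∧ F.Finite) ∧ e ∈ vCl F := by
      intro e he
      simpa only [Set.mem_iUnion, Set.mem_ofPred_eq, exists_prop] using hXY (hE he)
    choose! F hF1 hF2 using h1
    refine ⟨⋃ e ∈ E, F e, ⟨Set.iUnion₂_subset fun e he => (hF1 e he).1,
      hfin.biUnion fun e he => (hF1 e he).2⟩, vCl_sub (fun e he => ?_) hx⟩
    refine vCl_sub (fun f hf => ?_) (hF2 e he)
    exact sub_vCl _ (Or.inl ⟨f, Set.mem_biUnion he hf, 1, trivial, mul_one f⟩)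
  mul_cl c X := by
    ext z
    simp only [Set.mem_image, Set.mem_iUnion, Set.mem_ofPred_eq, exists_prop]
    constructor
    · rintro ⟨x, ⟨E, ⟨hE, hfin⟩, hx⟩, rfl⟩
      exact ⟨(fun x => c * x) '' E, ⟨Set.image_mono hE, hfin.image _⟩,
        mul_vCl c E ▸ ⟨x, hx, rfl⟩⟩
    · rintro ⟨E, ⟨hE, hfin⟩, hz⟩
      obtain ⟨E', hE', hfin', hz⟩ := (Set.exists_subset_image_finite_and
        (p := fun T => z ∈ vCl T)).1 ⟨E, hE, hfin, hz⟩
      rw [← mul_vCl] at hz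
      obtain ⟨x, hx, rfl⟩ := hz
      exact ⟨x, ⟨E', ⟨hE', hfin'⟩, hx⟩, rfl⟩
  finitary X := by
    ext z
    simp only [Set.mem_iUnion, Set.mem_ofPred_eq, exists_prop]
    constructor
    · rintro ⟨E, hE, hz⟩
      exact ⟨E, hE, E, ⟨subset_rfl, hE.2⟩, hz⟩
    · rintro ⟨E, hE, F, hF, hz⟩
      exact ⟨F, ⟨hF.1.trans hE.1, hF.2⟩, hz⟩

section Modularization

variable {H : Type*} [CommMonoid H] (p r : FinIdealSystem H)

/-- `X ↦ {x | xF ⊆ X_p and F_r = H for some F ⊆ H}`. -/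
def modCl (X : Set H) : Set H :=
  {x | ∃ F : Set H, (fun y => x * y) '' F ⊆ p.cl X ∧ r.cl F = Set.univ}

variable {p r}

theorem p_sub_modCl (X : Set H) : p.cl X ⊆ modCl p r X := fun x hx =>
  ⟨{1}, by simpa using hx, r.cl_eq_univ (r.subset_cl _ rfl)⟩

theorem modCl_finite {X : Set H} {x : H} (hx : x ∈ modCl p r X) :
    ∃ E N : Set H, E.Finite ∧ N.Finite ∧ N ⊆ X ∧ (fun y => x * y) '' E ⊆ p.cl N ∧
      r.cl E = Set.univ := by
  obtain ⟨F, hF, hF1⟩ := hx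
  obtain ⟨E, hEF, hE, h1⟩ := r.mem_cl_iff.1 (hF1 ▸ Set.mem_univ (1 : H))
  have h2 : ∀ e ∈ E, ∃ N ⊆ X, N.Finite ∧ x * e ∈ p.cl N := fun e he =>
    p.mem_cl_iff.1 (hF ⟨e, hEF he, rfl⟩)
  choose! N hN1 hN2 hN3 using h2
  refine ⟨E, ⋃ e ∈ E, N e, hE, hE.biUnion hN2, Set.iUnion₂_subset hN1, ?_, r.cl_eq_univ h1⟩
  rintro _ ⟨e, he, rfl⟩
  exact p.cl_mono (Set.subset_biUnion_of_mem he) (hN3 e he)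

theorem modCl_common {Y N : Set H} (hN : N.Finite) (h : N ⊆ modCl p r Y) :
    ∃ F : Set H, N * F ⊆ p.cl Y ∧ r.cl F = Set.univ := by
  induction N, hN using Set.Finite.induction_on with
  | empty => exact ⟨{1}, by simp, r.cl_eq_univ (r.subset_cl _ rfl)⟩
  | @insert a s _ _ ih =>
    obtain ⟨F, hF, hF1⟩ := ih ((Set.subset_insert _ _).trans h)
    obtain ⟨F', hF', hF1'⟩ := h (Set.mem_insert _ _)
    refine ⟨F * F', ?_, r.cl_mul_eq_univ hF1 hF1'⟩
    rintro _ ⟨n, hn, _, ⟨f, hf, f', hf', rfl⟩, rfl⟩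
    rcases hn with rfl | hn
    · have := p.mul_mem_cl (hF' ⟨f', hf', rfl⟩) f
      convert this using 1
      simp only; ac_rfl
    · have := p.mul_mem_cl (hF ⟨n, hn, f, hf, rfl⟩) f'
      convert this using 1
      simp only; ac_rfl

theorem modCl_sub_r (hpr : p.Finer r) (X : Set H) : modCl p r X ⊆ r.cl X := by
  rintro x ⟨F, hF, hF1⟩
  have := r.mul_mem_cl_image (X := F) (x := 1) x (hF1 ▸ trivial)
  rw [mul_one] at this
  exact r.cl_sub _ _ (hF.trans (hpr X)) this

variable [IsNonzeroCancel H]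

/-- The finitary ideal system `r̃_p` attached to `p ≤ r`; if `p` is modular, it is the
`p`-modularization of `r`. -/
def modularization (p r : FinIdealSystem H) (hpr : p.Finer r) : FinIdealSystem H where
  cl := modCl p r
  sub_cl X := (p.sub_cl X).trans (p_sub_modCl X)
  cl_sub X Y h := by
    intro x hx
    obtain ⟨E, N, -, hN, hNX, hE, hE1⟩ := modCl_finite hx
    obtain ⟨F, hF, hF1⟩ := modCl_common hN (hNX.trans h)
    refine ⟨E * F, ?_, r.cl_mul_eq_univ hE1 hF1⟩
    rintro _ ⟨_, ⟨e, he, f, hf, rfl⟩, rfl⟩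
    have h1 := p.mul_mem_cl_image f (hE ⟨e, he, rfl⟩)
    have h2 : (fun x => f * x) '' N ⊆ p.cl Y := by
      rintro _ ⟨n, hn, rfl⟩
      exact hF ⟨n, hn, f, hf, mul_comm _ _⟩
    have h3 := p.cl_sub _ _ h2 h1
    convert h3 using 1
    simp only; ac_rfl
  mul_cl c X := by
    ext z
    constructor
    · rintro ⟨x, ⟨F, hF, hF1⟩, rfl⟩
      refine ⟨F, ?_, hF1⟩
      rintro _ ⟨f, hf, rfl⟩
      simp only [mul_assoc]
      exact p.mul_mem_cl_image c (hF ⟨f, hf, rfl⟩)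
    · intro hz
      have hz' := modCl_sub_r hpr _ hz
      rw [← r.mul_cl] at hz'
      obtain ⟨v, -, rfl⟩ := hz'
      by_cases hc : c ∈ zeroSet H
      · exact ⟨c, p_sub_modCl X (p.sub_cl X (Or.inr hc)), by simp only [hc c, hc v]⟩
      · obtain ⟨F, hF, hF1⟩ := hz
        refine ⟨v, ⟨F, ?_, hF1⟩, rfl⟩
        rintro _ ⟨f, hf, rfl⟩
        have := hF ⟨f, hf, rfl⟩
        rw [← p.mul_cl] at this
        obtain ⟨y, hy, hyy⟩ := this
        have : y = v * f := IsNonzeroCancel.cancel c hc _ _ (by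
          simpa only [mul_assoc] using hyy)
        simpa only [← this] using hy
  finitary X := by
    ext z
    simp only [Set.mem_iUnion, Set.mem_ofPred_eq, exists_prop]
    constructor
    · intro hz
      obtain ⟨E, N, -, hN, hNX, hE, hE1⟩ := modCl_finite hz
      exact ⟨N, ⟨hNX, hN⟩, E, hE, hE1⟩
    · rintro ⟨N, ⟨hNX, -⟩, F, hF, hF1⟩
      exact ⟨F, hF.trans (p.cl_mono hNX), hF1⟩

end Modularization

/-- The `w`-system, i.e. the `s`-modularization of the `t`-system. -/
noncomputable def wSystem (H : Type*) [CommMonoid H] [IsNonzeroCancel H] : FinIdealSystem H :=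
  modularization (sSystem H) (tSystem H) (tSystem H).sub_cl

section Notions

variable {H : Type*} [CommMonoid H]

/-- `X` is a principal ideal: an `s`-ideal generated by at most one element. -/
def IsPrincipalIdeal (X : Set H) : Prop :=
  ∃ A : Set H, A.Subsingleton ∧ X = (sSystem H).cl A

/-- `X` is radical. -/
def IsRadical (X : Set H) : Prop := rad X = X

/-- `P` is a prime `s`-ideal. -/
structure IsPrimeIdeal (P : Set H) : Prop where
  sIdeal : (sSystem H).cl P = P
  ne_univ : P ≠ Set.univ
  mem_or_mem : ∀ x y : H, x * y ∈ P → x ∈ P ∨ y ∈ P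

/-- The multiplicatively closed set `H \ P`. -/
def IsPrimeIdeal.compl {P : Set H} (hP : IsPrimeIdeal P) : Submonoid H where
  carrier := Pᶜ
  one_mem' h := hP.ne_univ (Set.eq_univ_of_forall fun x => by
    rw [← hP.sIdeal]
    exact Or.inl ⟨1, h, x, trivial, one_mul x⟩)
  mul_mem' hx hy h := (hP.mem_or_mem _ _ h).elim hx hy

theorem IsPrimeIdeal.zero_notMem_compl {P : Set H} (hP : IsPrimeIdeal P) {s : H}
    (hs : s ∈ hP.compl) : s ∉ zeroSet H := fun h0 =>
  hs (hP.sIdeal ▸ (Or.inr h0 : s ∈ (sSystem H).cl P))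

/-- The localization `H_P = (H \ P)⁻¹H`. -/
abbrev LocAt {P : Set H} (hP : IsPrimeIdeal P) : Type _ := Localization hP.compl

namespace FinIdealSystem

variable (r : FinIdealSystem H)

/-- `X` is an `r`-ideal. -/
def IsIdeal (X : Set H) : Prop := r.cl X = X

/-- `M` is an `r`-maximal `r`-ideal, i.e. maximal among the proper `r`-ideals. -/
def IsMax (M : Set H) : Prop := Maximal (fun I => r.IsIdeal I ∧ I ≠ Set.univ) M

variable {r} in
theorem IsMax.isPrime {M : Set H} (hM : r.IsMax M) : IsPrimeIdeal M where
  sIdeal := by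
    refine Set.Subset.antisymm ?_ ((sSystem H).subset_cl M)
    exact (r.sub_cl M).trans hM.1.1.subset
  ne_univ := hM.1.2
  mem_or_mem x y hxy := by
    by_contra! h
    have h1 : r.cl (M ∪ {x}) = Set.univ := by
      by_contra hne
      have hid : r.IsIdeal (r.cl (M ∪ {x})) :=
        Set.Subset.antisymm (r.cl_sub _ _ subset_rfl) (r.subset_cl _)
      have hsub := Set.subset_union_left.trans (r.subset_cl (M ∪ {x}))
      exact h.1 (hM.2 ⟨hid, hne⟩ hsub (r.subset_cl _ (Or.inr rfl)))
    have h2 := r.mul_mem_cl_image (X := M ∪ {x}) (x := 1) y (h1 ▸ trivial)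
    rw [mul_one] at h2
    have hM' : r.cl M = M := hM.1.1
    have h3 : (fun z => y * z) '' (M ∪ {x}) ⊆ r.cl M := by
      rintro _ ⟨z, hz | rfl, rfl⟩
      · simp only [mul_comm y]
        exact r.mul_mem_cl (r.subset_cl _ hz) y
      · simp only [mul_comm y]
        exact r.subset_cl _ hxy
    exact h.2 (hM' ▸ r.cl_sub _ _ h3 h2)

/-- `I` is the `r`-product of the finite family `L` of subsets of `H`. -/
def IsProd (I : Set H) (L : List (Set H)) : Prop := I = r.cl L.prod

/-- `H` is an `r`-SP-monoid. -/
def IsSP : Prop :=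
  ∀ I, r.IsIdeal I → ∃ L : List (Set H), (∀ J ∈ L, r.IsIdeal J ∧ IsRadical J) ∧ r.IsProd I L

/-- `I` is `r`-finitely generated. -/
def IsFG (I : Set H) : Prop := r.IsIdeal I ∧ ∃ E ⊆ I, E.Finite ∧ I = r.cl E

/-- `H` is an `r`-finite conductor monoid. -/
def IsFiniteConductor : Prop :=
  ∀ x y : H, r.IsFG ((sSystem H).cl {x} ∩ (sSystem H).cl {y})

end FinIdealSystem

variable [IsNonzeroCancel H]

/-- `X` is an `r`-invertible `r`-ideal: `X_r = X` and `(XX⁻¹)_r = H`. -/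
def FinIdealSystem.IsInvertible (r : FinIdealSystem H) (X : Set H) : Prop :=
  r.IsIdeal X ∧ r.cl (incl H ⁻¹' ((incl H '' X) * invSet (incl H '' X))) = Set.univ

/-- Localizations at prime ideals satisfy the standing convention on monoids. -/
instance instLocAt {P : Set H} (hP : IsPrimeIdeal P) : IsNonzeroCancel (LocAt hP) where
  exists_pair_ne := by
    obtain ⟨a, b, hab⟩ := exists_pair_ne H
    refine ⟨Localization.mk a 1, Localization.mk b 1, fun h => hab ?_⟩
    rw [Localization.mk_eq_mk_iff, Localization.r_iff_exists] at h
    obtain ⟨c, hc⟩ := h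
    have := IsNonzeroCancel.cancel (c : H) (hP.zero_notMem_compl c.2) _ _ hc
    simpa using this
  cancel := by
    intro g hg x y hxy
    induction g using Localization.induction_on with | _ g
    induction x using Localization.induction_on with | _ x
    induction y using Localization.induction_on with | _ y
    obtain ⟨a, s⟩ := g
    obtain ⟨b, u⟩ := x
    obtain ⟨c, v⟩ := y
    have ha : a ∉ zeroSet H := by
      intro ha
      apply hg
      intro k
      induction k using Localization.induction_on with | _ k
      obtain ⟨d, w⟩ := k
      rw [Localization.mk_mul, Localization.mk_eq_mk_iff, Localization.r_iff_exists]
      refine ⟨1, ?_⟩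
      simp only [Submonoid.coe_mul, ha d, mul_comm _ a, ha _]
    simp only [Localization.mk_mul, Localization.mk_eq_mk_iff, Localization.r_iff_exists] at hxy ⊢
    obtain ⟨e, he⟩ := hxy
    have h0 : ∀ q : hP.compl, (q : H) ∉ zeroSet H := fun q => hP.zero_notMem_compl q.2
    refine ⟨1, ?_⟩
    simp only [Submonoid.coe_mul, Submonoid.coe_one, one_mul] at he ⊢
    refine IsNonzeroCancel.cancel ((e : H) * s * a)
      (mul_notMem_zeroSet (mul_notMem_zeroSet (h0 e) (h0 s)) ha) _ _ ?_
    convert he using 1 <;> ac_rfl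

/-- `K` is a discrete valuation monoid. -/
def IsDVM (K : Type*) [CommMonoid K] [IsNonzeroCancel K] : Prop :=
  ¬ EqQuot K ∧ ∀ X : Set K, (sSystem K).IsIdeal X → IsPrincipalIdeal X

/-- `H` is an `r`-almost Dedekind monoid. -/
def FinIdealSystem.IsAlmostDedekind (r : FinIdealSystem H) : Prop :=
  EqQuot H ∨ ∀ (M : Set H) (hM : r.IsMax M), IsDVM (LocAt hM.isPrime)

/-- The radical of every nontrivial principal ideal of `H` is `r`-invertible. -/
def FinIdealSystem.RadPrincipalInvertible (r : FinIdealSystem H) : Prop :=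
  ∀ I : Set H, IsPrincipalIdeal I → zeroSet H ⊂ I → r.IsInvertible (rad I)

end Notions

end IdealSys

/-! If `H = G`, every nonzero element is a unit, so `z(H)` and `H` are the only ideals and all
conditions hold. Otherwise everything is tested locally at the `t`-maximal ideals `M`, in terms of
divisibility up to factors outside `M` (`LDvd`), without passing to the localizations. Two
translations make this possible. An element lies in `X_w` iff it lies in `X_s` locally at every `M`
(`mem_wSystem_cl`). An ideal is `t`- or `w`-invertible iff at every `M` some fraction maps it into
`H` and one of its elements outside `M` (`InvAt`); such an element then generates the ideal locally.
As radicals of principal ideals are ideals in both systems, `t`- and `w`-invertibility agree for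
them.

The pivot is that each of the conditions forces `H_M` to be a discrete valuation monoid
(`IsLocVal`). A radical factorization of a principal ideal makes its generator locally a product of
locally radical elements, so it is enough that elements of `M` be comparable with locally radical
ones (`exists_isLocVal_of_comparable`). For `w`-SP-monoids this comes from factoring the ideal
locally generated by `a²` and `b`. In the finite conductor case, radical factorizations give
complete integral closure, which makes every `aH ∩ bH` invertible and hence any two elements locally
comparable. If radicals of principal ideals are invertible, all locally radical nonzero elements of
`M` are associated, because no invertible ideal can lie between `jH ∩ kH` and, locally, `(jk)` when
`j` and `k` are in `M` (`not_invAt_of_lDvd_mul`).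

Given the valuations, `t = w`, which links the `t`-statement with the `w`-statement, and radical
factorizations of principal ideals yield invertible radicals. Conversely, invertible radicals make
the values of a nonzero element bounded over all `M` and upper semicontinuous in `M`. Any nonzero
`w`-ideal `I` is then the `w`-product of the finitely many level ideals `⋂ {M | v_M(I) > k}`, which
are radical and form a chain (`exists_comparable_factorization`). -/

namespace IdealSys

/-! ### Divisibility up to factors outside a prime ideal. -/

section LocalDivisibility

variable {H : Type*} [CommMonoid H]

/-- Divisibility in the localization at `M`: `x` divides `y` up to a factor outside `M`. -/
def LDvd (M : Set H) (x y : H) : Prop := ∃ s, s ∉ M ∧ x ∣ s * y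

/-- `a` generates a radical ideal in the localization at `M`. -/
def LRad (M : Set H) (a : H) : Prop := ∀ (y : H) (n : ℕ), 0 < n → LDvd M a (y ^ n) → LDvd M a y

theorem dvd_of_mem_zeroSet {z : H} (hz : z ∈ zeroSet H) (x : H) : x ∣ z :=
  ⟨z, by rw [mul_comm, hz]⟩

theorem mem_zeroSet_of_dvd {x y : H} (hx : x ∈ zeroSet H) (h : x ∣ y) : y ∈ zeroSet H := by
  obtain ⟨c, rfl⟩ := h
  exact zero_mul_mem hx c

theorem notMem_zeroSet_of_dvd {x y : H} (h : x ∣ y) (hy : y ∉ zeroSet H) : x ∉ zeroSet H :=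
  fun hx => hy (mem_zeroSet_of_dvd hx h)

theorem mem_sSystem_cl {X : Set H} {x : H} :
    x ∈ (sSystem H).cl X ↔ (∃ a ∈ X, a ∣ x) ∨ x ∈ zeroSet H := by
  constructor
  · rintro (⟨a, ha, b, -, rfl⟩ | h)
    · exact Or.inl ⟨a, ha, b, rfl⟩
    · exact Or.inr h
  · rintro (⟨a, ha, b, rfl⟩ | h)
    · exact Or.inl ⟨a, ha, b, trivial, rfl⟩
    · exact Or.inr h

theorem mem_sSystem_cl_singleton {a x : H} : x ∈ (sSystem H).cl {a} ↔ a ∣ x := by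
  rw [mem_sSystem_cl]
  constructor
  · rintro (⟨b, rfl, h⟩ | h)
    · exact h
    · exact dvd_of_mem_zeroSet h a
  · exact fun h => Or.inl ⟨a, rfl, h⟩

section Cancel

variable [IsNonzeroCancel H]

theorem eq_of_mul_eq_mul {c x y : H} (hc : c ∉ zeroSet H) (h : c * x = c * y) : x = y :=
  IsNonzeroCancel.cancel c hc _ _ h

theorem dvd_of_mul_dvd_mul {c x y : H} (hc : c ∉ zeroSet H) (h : c * x ∣ c * y) : x ∣ y := by
  obtain ⟨d, hd⟩ := h
  exact ⟨d, eq_of_mul_eq_mul hc (by rw [hd, mul_assoc])⟩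

theorem pow_notMem_zeroSet {a : H} (ha : a ∉ zeroSet H) (n : ℕ) : a ^ n ∉ zeroSet H :=
  (nonzero H).pow_mem ha n

theorem isUnit_of_eqQuot (h : EqQuot H) {a : H} (ha : a ∉ zeroSet H) : IsUnit a := by
  obtain ⟨u, hu⟩ := (incl_isUnit ha).exists_right_inv
  obtain ⟨d, hd⟩ := h u
  exact IsUnit.of_mul_eq_one d (incl_injective (by rw [map_mul, hd, hu, map_one]))

end Cancel

theorem lDvd_of_notMem {M : Set H} {x : H} (hx : x ∉ M) (y : H) : LDvd M x y :=
  ⟨x, hx, dvd_mul_right x y⟩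

namespace IsPrimeIdeal

variable {M : Set H} (hM : IsPrimeIdeal M)
include hM

theorem one_notMem : (1 : H) ∉ M := hM.compl.one_mem

theorem mul_notMem {x y : H} (hx : x ∉ M) (hy : y ∉ M) : x * y ∉ M := hM.compl.mul_mem hx hy

theorem pow_notMem {x : H} (hx : x ∉ M) (n : ℕ) : x ^ n ∉ M := hM.compl.pow_mem hx n

theorem mem_of_dvd {x y : H} (hx : x ∈ M) (h : x ∣ y) : y ∈ M :=
  hM.sIdeal ▸ mem_sSystem_cl.2 (Or.inl ⟨x, hx, h⟩)

theorem notMem_of_dvd {x y : H} (h : x ∣ y) (hy : y ∉ M) : x ∉ M := fun hx => hy (hM.mem_of_dvd hx h)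

theorem mem_of_pow_mem {x : H} {n : ℕ} (h : x ^ n ∈ M) : x ∈ M := by
  by_contra hx
  exact hM.pow_notMem hx n h

theorem zeroSet_subset : zeroSet H ⊆ M := fun _ h =>
  hM.sIdeal ▸ mem_sSystem_cl.2 (Or.inr h)

theorem notMem_zeroSet {x : H} (hx : x ∉ M) : x ∉ zeroSet H := fun h => hx (hM.zeroSet_subset h)

theorem lDvd_of_dvd {x y : H} (h : x ∣ y) : LDvd M x y := ⟨1, hM.one_notMem, by simpa⟩

theorem lDvd_refl (x : H) : LDvd M x x := hM.lDvd_of_dvd dvd_rfl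

theorem lDvd_trans {x y z : H} (h : LDvd M x y) (h' : LDvd M y z) : LDvd M x z := by
  obtain ⟨s, hs, h⟩ := h
  obtain ⟨t, ht, h'⟩ := h'
  refine ⟨s * t, hM.mul_notMem hs ht, h.trans ?_⟩
  rw [mul_assoc]
  exact mul_dvd_mul_left s h'

theorem lDvd_mul {x y x' y' : H} (h : LDvd M x y) (h' : LDvd M x' y') :
    LDvd M (x * x') (y * y') := by
  obtain ⟨s, hs, h⟩ := h
  obtain ⟨t, ht, h'⟩ := h'
  refine ⟨s * t, hM.mul_notMem hs ht, ?_⟩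
  rw [mul_mul_mul_comm]
  exact mul_dvd_mul h h'

theorem lDvd_pow {x y : H} (h : LDvd M x y) (n : ℕ) : LDvd M (x ^ n) (y ^ n) := by
  obtain ⟨s, hs, h⟩ := h
  refine ⟨s ^ n, hM.pow_notMem hs n, ?_⟩
  rw [← mul_pow]
  exact pow_dvd_pow_of_dvd h n

theorem lDvd_of_lDvd_mul {x y s : H} (hs : s ∉ M) (h : LDvd M x (s * y)) : LDvd M x y := by
  obtain ⟨t, ht, h⟩ := h
  exact ⟨t * s, hM.mul_notMem ht hs, by rwa [mul_assoc]⟩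

theorem mem_of_lDvd {x y : H} (hx : x ∈ M) (h : LDvd M x y) : y ∈ M := by
  obtain ⟨s, hs, h⟩ := h
  exact (hM.mem_or_mem _ _ (hM.mem_of_dvd hx h)).resolve_left hs

theorem notMem_zeroSet_of_lDvd [IsNonzeroCancel H] {x y : H} (h : LDvd M x y)
    (hy : y ∉ zeroSet H) : x ∉ zeroSet H := by
  obtain ⟨s, hs, h⟩ := h
  exact notMem_zeroSet_of_dvd h (mul_notMem_zeroSet (hM.notMem_zeroSet hs) hy)

/-- A square of an element of `M` does not divide, locally at `M`, an element that is radical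
locally at `M`. -/
theorem not_sq_lDvd [IsNonzeroCancel H] {a b : H} (ha : a ∈ M) (hb : b ∉ zeroSet H)
    (hrad : LRad M b) : ¬ LDvd M (a * a) b := by
  rintro ⟨s, hs, e, he⟩
  -- From `s * b = a² * e`, the square of `a * e` is a multiple of `b`. Hence `b` divides `a * e`
  -- locally, and cancelling makes `a` a local unit.
  obtain ⟨t, ht, w, hw⟩ := hrad (a * e) 2 two_pos
    (hM.lDvd_of_dvd ⟨s * e, by rw [sq]; calc
      a * e * (a * e) = (a * a * e) * e := by ac_rfl
      _ = b * (s * e) := by rw [← he]; ac_rfl⟩)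
  have hz : a * e ∉ zeroSet H := by
    have : a * e ∣ s * b := ⟨a, by rw [he]; ac_rfl⟩
    exact notMem_zeroSet_of_dvd this (mul_notMem_zeroSet (hM.notMem_zeroSet hs) hb)
  have h1 : s * t = a * w := eq_of_mul_eq_mul hz (by
    calc a * e * (s * t) = s * (t * (a * e)) := by ac_rfl
      _ = s * b * w := by rw [hw]; ac_rfl
      _ = a * e * (a * w) := by rw [he]; ac_rfl)
  exact hM.mul_notMem hs ht (hM.mem_of_dvd ha ⟨w, h1⟩)

theorem lRad_mul {a s : H} (hs : s ∉ M) (h : LRad M a) : LRad M (s * a) := by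
  intro y n hn hy
  have h1 := h y n hn (hM.lDvd_trans (hM.lDvd_of_dvd (dvd_mul_left a s)) hy)
  have := hM.lDvd_mul (lDvd_of_notMem hs 1) h1
  rwa [one_mul] at this

theorem exists_mem_of_prod_mem {l : List H} (h : l.prod ∈ M) : ∃ i ∈ l, i ∈ M := by
  by_contra! hl
  exact list_prod_mem (S := hM.compl) (fun x hx => hl x hx) h

end IsPrimeIdeal

end LocalDivisibility

/-! ### Radicals, maximal ideals, and the local nature of the `w`-closure. -/

section Closures

variable {H : Type*} [CommMonoid H] (r : FinIdealSystem H)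

namespace FinIdealSystem

theorem isIdeal_cl (X : Set H) : r.IsIdeal (r.cl X) :=
  Set.Subset.antisymm (r.cl_sub _ _ subset_rfl) (r.subset_cl _)

variable {r} in
theorem IsIdeal.mem_of_dvd {I : Set H} (hI : r.IsIdeal I) {x y : H} (hx : x ∈ I) (h : x ∣ y) :
    y ∈ I := by
  obtain ⟨c, rfl⟩ := h
  have := r.mul_mem_cl (r.subset_cl I hx) c
  rwa [hI] at this

variable {r} in
theorem IsIdeal.zeroSet_subset {I : Set H} (hI : r.IsIdeal I) : zeroSet H ⊆ I := fun x hx => by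
  have : x ∈ r.cl I := r.sub_cl I (Or.inr hx)
  rwa [hI] at this

variable {r} in
theorem IsIdeal.cl_subset {I X : Set H} (hI : r.IsIdeal I) (hX : X ⊆ I) : r.cl X ⊆ I := by
  have := r.cl_mono hX
  rwa [hI] at this

theorem cl_singleton (a : H) : r.cl {a} = (sSystem H).cl {a} := by
  have h := r.mul_cl a {1}
  rw [r.cl_eq_univ (X := {1}) (r.subset_cl _ rfl), Set.image_singleton, mul_one] at h
  rw [← h]
  ext x
  rw [mem_sSystem_cl_singleton]
  constructor
  · rintro ⟨y, -, rfl⟩; exact ⟨y, rfl⟩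
  · rintro ⟨y, rfl⟩; exact ⟨y, trivial, rfl⟩

theorem isIdeal_singleton (a : H) : r.IsIdeal ((sSystem H).cl {a}) := by
  rw [← r.cl_singleton]; exact r.isIdeal_cl _

theorem cl_mul_subset (X Y : Set H) : r.cl X * r.cl Y ⊆ r.cl (X * Y) := by
  have key : ∀ X Y : Set H, X * r.cl Y ⊆ r.cl (X * Y) := by
    rintro X Y _ ⟨x, hx, y, hy, rfl⟩
    refine r.cl_mono ?_ (r.mul_mem_cl_image x hy)
    rintro _ ⟨y, hy, rfl⟩
    exact ⟨x, hx, y, hy, rfl⟩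
  refine (key _ _).trans (r.cl_sub _ _ ?_)
  rw [mul_comm, mul_comm X]
  exact key _ _

theorem cl_pow_subset (X : Set H) (n : ℕ) : r.cl X ^ n ⊆ r.cl (X ^ n) := by
  induction n with
  | zero => simpa using r.subset_cl 1
  | succ n ih =>
    rw [pow_succ, pow_succ]
    exact (Set.mul_subset_mul_right ih).trans (r.cl_mul_subset _ _)

variable {r} in
/-- The radical of an ideal is an ideal. -/
theorem IsIdeal.rad {I : Set H} (hI : r.IsIdeal I) : r.IsIdeal (rad I) := by
  refine Set.Subset.antisymm ?_ (r.subset_cl _)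
  intro x hx
  obtain ⟨E, hE, hfin, hx⟩ := r.mem_cl_iff.1 hx
  -- A single exponent serves for the finite set `E`, by pigeonhole on the factors of a long
  -- product; it then serves for the whole closure of `E`, as `cl(E)^n ⊆ cl(E^n)`.
  have key : ∃ n : ℕ, 0 < n ∧ E ^ n ⊆ I := by
    clear hx
    induction E, hfin using Set.Finite.induction_on with
    | empty => exact ⟨1, one_pos, by simp⟩
    | @insert a s _ _ ih =>
      obtain ⟨n, hn, h⟩ := ih ((Set.subset_insert _ _).trans hE)
      obtain ⟨m, hm, ha⟩ := hE (Set.mem_insert a s)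
      refine ⟨n + m, by omega, ?_⟩
      have h2 : ∀ k : ℕ, ∀ y ∈ (insert a s) ^ k, ∃ i j : ℕ, i + j = k ∧ ∃ q ∈ s ^ j,
          y = a ^ i * q := by
        intro k
        induction k with
        | zero => intro y hy; exact ⟨0, 0, rfl, 1, by simp, by simpa using hy⟩
        | succ k ihk =>
          rintro _ hy
          rw [pow_succ] at hy
          obtain ⟨y, hy, b, hb, rfl⟩ := hy
          obtain ⟨i, j, hij, q, hq, rfl⟩ := ihk y hy
          rcases hb with rfl | hb
          · exact ⟨i + 1, j, by omega, q, hq, by simp only [pow_succ]; ac_rfl⟩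
          · exact ⟨i, j + 1, by omega, q * b, by rw [pow_succ]; exact ⟨q, hq, b, hb, rfl⟩,
              by simp only [mul_assoc]⟩
      intro y hy
      obtain ⟨i, j, hij, q, hq, rfl⟩ := h2 _ y hy
      by_cases him : m ≤ i
      · exact hI.mem_of_dvd ha ((pow_dvd_pow a him).trans (dvd_mul_right _ _))
      · have hj : n ≤ j := by omega
        obtain ⟨d, rfl⟩ := Nat.exists_eq_add_of_le hj
        rw [pow_add] at hq
        obtain ⟨q1, h1, q2, -, rfl⟩ := hq
        exact hI.mem_of_dvd (h h1) ⟨a ^ i * q2, by simp only; ac_rfl⟩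
  obtain ⟨n, hn, h⟩ := key
  refine ⟨n, hn, ?_⟩
  exact hI.cl_subset h (r.cl_pow_subset E n (Set.pow_mem_pow hx))

/-- Zorn's lemma applies because the system is finitary: an element of the closure of a union of a
chain already lies in a member of the chain. -/
theorem exists_isMax {I : Set H} (hI : r.IsIdeal I) (h1 : (1 : H) ∉ I) :
    ∃ M, r.IsMax M ∧ I ⊆ M := by
  have h := zorn_subset_nonempty {J : Set H | r.IsIdeal J ∧ J ≠ Set.univ} ?_ I
    ⟨hI, fun h => h1 (h ▸ trivial)⟩
  · obtain ⟨M, hIM, hM⟩ := h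
    exact ⟨M, hM, hIM⟩
  · intro c hc hchain hne
    refine ⟨⋃₀ c, ⟨?_, ?_⟩, fun s hs => Set.subset_sUnion_of_mem hs⟩
    · refine Set.Subset.antisymm ?_ (r.subset_cl _)
      intro x hx
      obtain ⟨E, hE, hfin, hx⟩ := r.mem_cl_iff.1 hx
      obtain ⟨J, hJ, hEJ⟩ := hchain.directedOn.exists_mem_subset_of_finite_of_subset_sUnion hne hfin hE
      exact ⟨J, hJ, (hc hJ).1.cl_subset hEJ hx⟩
    · intro h
      obtain ⟨J, hJ, h1⟩ := (h ▸ trivial : (1 : H) ∈ ⋃₀ c)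
      exact (hc hJ).2 ((hc hJ).1 ▸ r.cl_eq_univ (r.subset_cl _ h1))

theorem cl_eq_univ_iff {X : Set H} : r.cl X = Set.univ ↔ ∀ M, r.IsMax M → ∃ x ∈ X, x ∉ M := by
  constructor
  · intro h M hM
    by_contra! hX
    exact hM.1.2 (Set.univ_subset_iff.1 (h ▸ hM.1.1.cl_subset hX))
  · intro h
    refine r.cl_eq_univ ?_
    by_contra h1
    obtain ⟨M, hM, hXM⟩ := r.exists_isMax (r.isIdeal_cl X) h1
    obtain ⟨x, hx, hxM⟩ := h M hM
    exact hxM (hXM (r.subset_cl _ hx))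

end FinIdealSystem

variable [IsNonzeroCancel H]

/-- The largest candidate for `F` is the set of all `s` with `s * x ∈ X_s`, and `F_t = H` means that
`F` is contained in no `t`-maximal ideal. -/
theorem mem_wSystem_cl {X : Set H} {x : H} :
    x ∈ (wSystem H).cl X ↔
      ∀ M, (tSystem H).IsMax M → ∃ s, s ∉ M ∧ s * x ∈ (sSystem H).cl X := by
  constructor
  · rintro ⟨F, hF, h1⟩ M hM
    obtain ⟨s, hs, hsM⟩ := (tSystem H).cl_eq_univ_iff.1 h1 M hM
    exact ⟨s, hsM, by simpa only [mul_comm s] using hF ⟨s, hs, rfl⟩⟩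
  · intro h
    refine ⟨{s | s * x ∈ (sSystem H).cl X}, ?_, (tSystem H).cl_eq_univ_iff.2 fun M hM => ?_⟩
    · rintro _ ⟨s, hs, rfl⟩
      have hs : s * x ∈ (sSystem H).cl X := hs
      simpa only [mul_comm x] using hs
    · obtain ⟨s, hs, h⟩ := h M hM
      exact ⟨s, h, hs⟩

theorem wSystem_finer : (wSystem H).Finer (tSystem H) := modCl_sub_r (tSystem H).sub_cl

theorem wSystem_isIdeal_of_tSystem {I : Set H} (hI : (tSystem H).IsIdeal I) :
    (wSystem H).IsIdeal I :=
  Set.Subset.antisymm ((wSystem_finer I).trans hI.subset) ((wSystem H).subset_cl _)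

/-- If `X_t = H`, then `F = X` witnesses `1 ∈ X_w`. This is why the same local criterion describes
`w`- and `t`-invertibility. -/
theorem wSystem_cl_eq_univ_iff {X : Set H} :
    (wSystem H).cl X = Set.univ ↔ (tSystem H).cl X = Set.univ := by
  constructor
  · intro h
    exact Set.univ_subset_iff.1 (h ▸ wSystem_finer X)
  · intro h
    refine (wSystem H).cl_eq_univ ⟨X, ?_, h⟩
    simpa using (sSystem H).subset_cl X

theorem mem_of_local {I : Set H} (hI : (wSystem H).IsIdeal I) {x : H}
    (h : ∀ M, (tSystem H).IsMax M → ∃ s, s ∉ M ∧ s * x ∈ I) : x ∈ I := by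
  rw [← hI, mem_wSystem_cl]
  intro M hM
  obtain ⟨s, hs, h⟩ := h M hM
  exact ⟨s, hs, (sSystem H).subset_cl _ h⟩

theorem dvd_of_local {a x : H} (h : ∀ M, (tSystem H).IsMax M → LDvd M a x) : a ∣ x := by
  rw [← mem_sSystem_cl_singleton]
  refine mem_of_local ((wSystem H).isIdeal_singleton a) fun M hM => ?_
  obtain ⟨s, hs, h⟩ := h M hM
  exact ⟨s, hs, mem_sSystem_cl_singleton.2 h⟩

/-- Preimages of principal ideals under multiplication by `b` are `w`-closed, so divisibility
statements about generators extend to the whole `w`-ideal. -/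
theorem dvd_of_mem_wSystem_cl {X : Set H} {a b x : H} (hX : ∀ y ∈ X, a ∣ b * y)
    (hx : x ∈ (wSystem H).cl X) : a ∣ b * x := by
  refine dvd_of_local fun M hM => ?_
  obtain ⟨s, hs, h⟩ := mem_wSystem_cl.1 hx M hM
  refine ⟨s, hs, ?_⟩
  rcases mem_sSystem_cl.1 h with ⟨y, hy, e, he⟩ | h
  · have h1 : s * (b * x) = b * y * e := by rw [mul_assoc b, ← he]; ac_rfl
    rw [h1]
    exact (hX y hy).mul_right e
  · refine dvd_of_mem_zeroSet ?_ a
    rw [mul_left_comm, mul_comm]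
    exact zero_mul_mem h b

/-- A fraction-free description of the `v`-closure. -/
theorem mem_vCl_iff (h : ¬ EqQuot H) {X : Set H} {x : H} :
    x ∈ vCl X ↔ ∀ c d : H, d ∉ zeroSet H → (∀ y ∈ X, d ∣ c * y) → d ∣ c * x := by
  -- Writing `g = c / d`, the condition `g * y ∈ H` becomes `d ∣ c * y`.
  have key : ∀ (g : QuotMonoid H) (c d : H), d ∉ zeroSet H → g * incl H d = incl H c → ∀ y : H,
      g * incl H y ∈ Set.range (incl H) ↔ d ∣ c * y := by
    intro g c d hd hg y
    constructor
    · rintro ⟨k, hk⟩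
      refine ⟨k, incl_injective ?_⟩
      rw [map_mul, map_mul, hk, ← hg]; ac_rfl
    · rintro ⟨k, hk⟩
      refine ⟨k, ?_⟩
      obtain ⟨u, hu⟩ := (incl_isUnit hd).exists_right_inv
      have h1 : incl H d * (g * incl H y) = incl H d * incl H k := by
        rw [← map_mul (incl H) d k, ← hk, map_mul, ← hg]; ac_rfl
      exact ((incl_isUnit hd).mul_left_cancel h1).symm
  rw [mem_vCl_of_ne h]
  constructor
  · intro hx c d hd hc
    obtain ⟨u, hu⟩ := (incl_isUnit hd).exists_right_inv
    have hg : incl H c * u * incl H d = incl H c := by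
      rw [mul_assoc, mul_comm u, hu, mul_one]
    rw [← key _ c d hd hg, mul_comm]
    exact hx _ fun y hy => (key _ c d hd hg y).2 (hc y hy)
  · intro hx g hg
    obtain ⟨c, d, hd, hc⟩ := exists_mul_incl g
    rw [mul_comm, key g c d hd hc]
    exact hx c d hd fun y hy => (key g c d hd hc y).1 (hg y hy)

theorem vCl_subset_tSystem_cl {E X : Set H} (hE : E ⊆ X) (hfin : E.Finite) :
    vCl E ⊆ (tSystem H).cl X := Set.subset_biUnion_of_mem (u := fun E => vCl E) ⟨hE, hfin⟩

theorem tSystem_cl_empty : (tSystem H).cl ∅ = zeroSet H := by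
  refine Set.Subset.antisymm ?_ (Set.subset_union_right.trans ((tSystem H).sub_cl ∅))
  refine Set.iUnion₂_subset fun E hE => (vCl_zero ?_).subset
  rw [Set.subset_empty_iff.1 hE.1]; exact Set.empty_subset _

theorem wSystem_cl_empty : (wSystem H).cl ∅ = zeroSet H :=
  Set.Subset.antisymm ((wSystem_finer ∅).trans tSystem_cl_empty.subset)
    (Set.subset_union_right.trans ((wSystem H).sub_cl ∅))

theorem isRadical_zeroSet : IsRadical (zeroSet H) := by
  refine Set.Subset.antisymm ?_ fun x hx => ⟨1, one_pos, by simpa⟩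
  rintro x ⟨n, -, hx⟩
  by_contra h
  exact pow_notMem_zeroSet h n hx

/-- If `M` had only zero elements, maximality would make every nonzero element a unit, that is `H =
G`. -/
theorem isMax_exists_notMem_zeroSet (h : ¬ EqQuot H) {M : Set H} (hM : (tSystem H).IsMax M) :
    ∃ x ∈ M, x ∉ zeroSet H := by
  by_contra! hz
  apply h
  intro g
  obtain ⟨a, s, hs, hg⟩ := exists_mul_incl g
  have h1 : (1 : H) ∈ (sSystem H).cl {s} := by
    by_contra h1
    have := hM.2 ⟨(tSystem H).isIdeal_singleton s, fun h => h1 (h ▸ trivial)⟩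
      (fun x hx => mem_sSystem_cl_singleton.2 (dvd_of_mem_zeroSet (hz x hx) s))
    exact hs (hz s (this (mem_sSystem_cl_singleton.2 dvd_rfl)))
  obtain ⟨t, ht⟩ := mem_sSystem_cl_singleton.1 h1
  refine ⟨a * t, ?_⟩
  rw [map_mul, ← hg, mul_assoc, ← map_mul, ← ht, map_one, mul_one]

end Closures

/-! ### Invertibility as a local condition. -/

section Invertibility

variable {H : Type*} [CommMonoid H]

/-- `c / d` multiplies `X` into `H` and the element `a` of `X` to an element outside `M`. -/
def InvAt (M X : Set H) (a : H) : Prop :=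
  ∃ c d u : H, d ∉ zeroSet H ∧ u ∉ M ∧ c * a = d * u ∧ ∀ y ∈ X, d ∣ c * y

variable [IsNonzeroCancel H]

/-- Invertible means locally principal: as `c * a / d = u` is a local unit, `y` is locally `a` times
`c * y / d`. -/
theorem InvAt.lDvd {M X : Set H} {a : H} (h : InvAt M X a) {y : H} (hy : y ∈ X) : LDvd M a y := by
  obtain ⟨c, d, u, hd, hu, hca, h⟩ := h
  obtain ⟨w, hw⟩ := h y hy
  refine ⟨u, hu, w, eq_of_mul_eq_mul hd ?_⟩
  calc d * (u * y) = c * a * y := by rw [hca]; ac_rfl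
    _ = a * (c * y) := by ac_rfl
    _ = d * (a * w) := by rw [hw]; ac_rfl

theorem tSystem_cl_eq_univ_iff_invAt {X : Set H} :
    (tSystem H).cl (incl H ⁻¹' ((incl H '' X) * invSet (incl H '' X))) = Set.univ ↔
      ∀ M, (tSystem H).IsMax M → ∃ a ∈ X, InvAt M X a := by
  rw [FinIdealSystem.cl_eq_univ_iff]
  refine forall₂_congr fun M hM => ?_
  constructor
  · rintro ⟨u, ⟨_, ⟨a, ha, rfl⟩, g, hg, hu⟩, huM⟩
    obtain ⟨c, d, hd, hc⟩ := exists_mul_incl g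
    refine ⟨a, ha, c, d, u, hd, huM, incl_injective ?_, fun y hy => ?_⟩
    · rw [map_mul, map_mul, ← hc, ← hu]; ac_rfl
    · obtain ⟨k, hk⟩ := hg _ ⟨y, hy, rfl⟩
      refine ⟨k, incl_injective ?_⟩
      rw [map_mul, map_mul, ← hc, hk]; ac_rfl
  · rintro ⟨a, ha, c, d, u, hd, huM, hca, h⟩
    obtain ⟨e, he⟩ := (incl_isUnit hd).exists_right_inv
    refine ⟨u, ⟨_, ⟨a, ha, rfl⟩, e * incl H c, ?_, ?_⟩, huM⟩
    · rintro _ ⟨y, hy, rfl⟩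
      obtain ⟨k, hk⟩ := h y hy
      refine ⟨k, ?_⟩
      rw [mul_assoc, ← map_mul, hk, map_mul, ← mul_assoc, mul_comm e, he, one_mul]
    · calc incl H a * (e * incl H c) = e * incl H (c * a) := by rw [map_mul]; ac_rfl
        _ = (incl H d * e) * incl H u := by rw [hca, map_mul]; ac_rfl
        _ = incl H u := by rw [he, one_mul]

theorem wSystem_isInvertible_iff {X : Set H} :
    (wSystem H).IsInvertible X ↔
      (wSystem H).IsIdeal X ∧ ∀ M, (tSystem H).IsMax M → ∃ a ∈ X, InvAt M X a := by
  rw [FinIdealSystem.IsInvertible, wSystem_cl_eq_univ_iff, tSystem_cl_eq_univ_iff_invAt]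

theorem tSystem_isInvertible_iff {X : Set H} :
    (tSystem H).IsInvertible X ↔
      (tSystem H).IsIdeal X ∧ ∀ M, (tSystem H).IsMax M → ∃ a ∈ X, InvAt M X a := by
  rw [FinIdealSystem.IsInvertible, tSystem_cl_eq_univ_iff_invAt]

/-- A `w`-ideal that is locally invertible is `w`-finitely generated. -/
theorem isFG_of_invAt {X : Set H} (hX : (wSystem H).IsIdeal X)
    (h : ∀ M, (tSystem H).IsMax M → ∃ a ∈ X, InvAt M X a) : (wSystem H).IsFG X := by
  refine ⟨hX, ?_⟩
  -- Each `u ∈ U` carries `X` into a principal ideal generated by an element of `X`. Since `U_t =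
  -- H`, finitely many `u` already have `t`-closure `H`, and the corresponding elements of `X`
  -- generate it.
  set U : Set H := {u | ∃ a ∈ X, ∀ y ∈ X, a ∣ u * y}
  have h1 : (tSystem H).cl U = Set.univ := by
    refine (tSystem H).cl_eq_univ_iff.2 fun M hM => ?_
    obtain ⟨a, ha, c, d, u, hd, hu, hca, h⟩ := h M hM
    refine ⟨u, ⟨a, ha, fun y hy => ?_⟩, hu⟩
    obtain ⟨w, hw⟩ := h y hy
    refine ⟨w, eq_of_mul_eq_mul hd ?_⟩
    calc d * (u * y) = c * a * y := by rw [hca]; ac_rfl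
      _ = a * (c * y) := by ac_rfl
      _ = d * (a * w) := by rw [hw]; ac_rfl
  obtain ⟨F, hF, hfin, hF1⟩ := (tSystem H).mem_cl_iff.1 (h1 ▸ Set.mem_univ (1 : H))
  have hF' : ∀ u ∈ F, ∃ a ∈ X, ∀ y ∈ X, a ∣ u * y := fun u hu => hF hu
  choose! a ha hdvd using hF'
  refine ⟨a '' F, ?_, hfin.image a, ?_⟩
  · rintro _ ⟨u, hu, rfl⟩; exact ha u hu
  · refine Set.Subset.antisymm (fun y hy => mem_wSystem_cl.2 fun M hM => ?_)
      (hX.cl_subset (by rintro _ ⟨u, hu, rfl⟩; exact ha u hu))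
    obtain ⟨u, hu, huM⟩ := (tSystem H).cl_eq_univ_iff.1 ((tSystem H).cl_eq_univ hF1) M hM
    exact ⟨u, huM, mem_sSystem_cl.2 (Or.inl ⟨a u, ⟨u, hu, rfl⟩, hdvd u hu y hy⟩)⟩

/-- Stated for any `r` with the local criterion, so that it serves both `t` and `w`. -/
theorem radPrincipal_of_forall (h : ∀ x : H, x ∉ zeroSet H → ∀ M, (tSystem H).IsMax M →
      ∃ a ∈ rad ((sSystem H).cl {x}), InvAt M (rad ((sSystem H).cl {x})) a)
    (r : FinIdealSystem H) (hr : ∀ X, r.IsInvertible X ↔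
      r.IsIdeal X ∧ ∀ M, (tSystem H).IsMax M → ∃ a ∈ X, InvAt M X a) :
    r.RadPrincipalInvertible := by
  rintro _ ⟨A, hA, rfl⟩ hz
  rcases hA.eq_empty_or_singleton with rfl | ⟨x, rfl⟩
  · refine absurd ?_ hz.2
    rintro y (⟨_, h, -⟩ | hy)
    · exact absurd h (Set.notMem_empty _)
    · exact hy
  · rw [hr]
    refine ⟨(r.isIdeal_singleton x).rad, h x fun hx => hz.2 fun y hy => ?_⟩
    exact mem_zeroSet_of_dvd hx (mem_sSystem_cl_singleton.1 hy)

theorem forall_of_radPrincipal (r : FinIdealSystem H) (hr : ∀ X, r.IsInvertible X ↔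
      r.IsIdeal X ∧ ∀ M, (tSystem H).IsMax M → ∃ a ∈ X, InvAt M X a)
    (h : r.RadPrincipalInvertible) (x : H) (hx : x ∉ zeroSet H) (M : Set H)
    (hM : (tSystem H).IsMax M) :
      ∃ a ∈ rad ((sSystem H).cl {x}), InvAt M (rad ((sSystem H).cl {x})) a := by
  refine ((hr _).1 (h ((sSystem H).cl {x}) ⟨{x}, Set.subsingleton_singleton, rfl⟩
    ⟨Set.subset_union_right, fun h => hx (h ?_)⟩)).2 M hM
  exact mem_sSystem_cl_singleton.2 dvd_rfl

/-- If locally at the `t`-maximal ideal `M` the ideal `(j) ∩ (k)` is generated by `jk`, then `j` and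
`k` cannot both be in `M`, provided that some ideal between the two is invertible. -/
theorem not_invAt_of_lDvd_mul (h : ¬ EqQuot H) {M : Set H} (hM : (tSystem H).IsMax M) {j k : H}
    (hj : j ∈ M) (hk : k ∈ M) (hj0 : j ∉ zeroSet H) (hk0 : k ∉ zeroSet H) {C : Set H}
    (hC : ∀ y, j ∣ y → k ∣ y → y ∈ C) (hCM : ∀ y ∈ C, LDvd M (j * k) y) {a : H} (ha : a ∈ C) :
    ¬ InvAt M C a := by
  rintro ⟨c, d, u, hd, hu, hca, hdvd⟩
  have hP := hM.isPrime
  obtain ⟨w, hw⟩ := hdvd (j * k) (hC _ ⟨k, rfl⟩ ⟨j, mul_comm _ _⟩)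
  -- Here `w = (c/d) * j * k`. Since `j * k` divides some `s * a` with `s ∉ M`, `w` divides `(c/d) *
  -- s * a = u * s`, which is outside `M`.
  have hwM : w ∉ M := by
    obtain ⟨s, hs, e, he⟩ := hCM a ha
    refine hP.notMem_of_dvd ⟨e, ?_⟩ (hP.mul_notMem hu hs)
    refine eq_of_mul_eq_mul hd ?_
    calc d * (u * s) = c * (s * a) := by rw [← mul_assoc, ← hca]; ac_rfl
      _ = c * (j * k) * e := by rw [he]; ac_rfl
      _ = d * (w * e) := by rw [hw]; ac_rfl
  -- If `c'/d'` sends `j, k` to `α, β`, then `j * β = k * α` is a common multiple of `j` and `k`,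
  -- hence in `C`, and `(c'/d') * w = (c/d) * (k * α) ∈ H`. Thus `w ∈ {j, k}_v ⊆ M`, a
  -- contradiction.
  have hwv : w ∈ vCl ({j, k} : Set H) := by
    rw [mem_vCl_iff h]
    intro c' d' hd' hcd
    obtain ⟨α, hα⟩ := hcd j (by simp)
    obtain ⟨β, hβ⟩ := hcd k (by simp)
    have h1 : j * β = k * α := eq_of_mul_eq_mul hd' (by
      calc d' * (j * β) = j * (d' * β) := by ac_rfl
        _ = k * (c' * j) := by rw [← hβ]; ac_rfl
        _ = d' * (k * α) := by rw [hα]; ac_rfl)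
    obtain ⟨e, he⟩ := hdvd (k * α) (hC _ ⟨β, h1.symm⟩ ⟨α, rfl⟩)
    refine ⟨e, eq_of_mul_eq_mul hd ?_⟩
    calc d * (c' * w) = c' * (c * (j * k)) := by rw [hw]; ac_rfl
      _ = c * k * (c' * j) := by ac_rfl
      _ = d' * (c * (k * α)) := by rw [hα]; ac_rfl
      _ = d * (d' * e) := by rw [he]; ac_rfl
  refine hwM (hM.1.1.subset (vCl_subset_tSystem_cl ?_ (by simp) hwv))
  rintro x (rfl | rfl)
  · exact hj
  · exact hk

end Invertibility

/-! ### Discrete valuations at `t`-maximal ideals, and `t = w`. -/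

section Valuation

variable {H : Type*} [CommMonoid H]

/-- `v` is a discrete valuation on the nonzero elements of the localization of `H` at `M`. -/
structure IsLocVal (M : Set H) (v : H → ℕ) : Prop where
  mul : ∀ x y, x ∉ zeroSet H → y ∉ zeroSet H → v (x * y) = v x + v y
  le_iff : ∀ x y, x ∉ zeroSet H → y ∉ zeroSet H → (v x ≤ v y ↔ LDvd M x y)
  exists_eq_one : ∃ p, p ∉ zeroSet H ∧ v p = 1

variable [IsNonzeroCancel H]

namespace IsLocVal

variable {M : Set H} {v : H → ℕ} (hv : IsLocVal M v)
include hv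

theorem one : v 1 = 0 := by
  have := hv.mul 1 1 one_notMem_zeroSet one_notMem_zeroSet
  rw [mul_one] at this
  omega

theorem pow {x : H} (hx : x ∉ zeroSet H) (n : ℕ) : v (x ^ n) = n * v x := by
  induction n with
  | zero => simp [hv.one]
  | succ n ih => rw [pow_succ, hv.mul _ _ (pow_notMem_zeroSet hx n) hx, ih]; ring

theorem eq_zero_iff (hM : IsPrimeIdeal M) {x : H} (hx : x ∉ zeroSet H) : v x = 0 ↔ x ∉ M := by
  have h := hv.le_iff x 1 hx one_notMem_zeroSet
  rw [hv.one, Nat.le_zero] at h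
  rw [h]
  exact ⟨fun h hxM => hM.one_notMem (hM.mem_of_lDvd hxM h), fun h => lDvd_of_notMem h 1⟩

omit [IsNonzeroCancel H] in
theorem le_of_dvd (hM : IsPrimeIdeal M) {x y : H} (hy : y ∉ zeroSet H) (h : x ∣ y) : v x ≤ v y :=
  (hv.le_iff x y (notMem_zeroSet_of_dvd h hy) hy).2 (hM.lDvd_of_dvd h)

omit [IsNonzeroCancel H] in
theorem lDvd_total (hM : IsPrimeIdeal M) (x y : H) : LDvd M x y ∨ LDvd M y x := by
  by_cases hx : x ∈ zeroSet H
  · exact Or.inr (hM.lDvd_of_dvd (dvd_of_mem_zeroSet hx y))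
  by_cases hy : y ∈ zeroSet H
  · exact Or.inl (hM.lDvd_of_dvd (dvd_of_mem_zeroSet hy x))
  rw [← hv.le_iff x y hx hy, ← hv.le_iff y x hy hx]
  exact le_total _ _

end IsLocVal

/-- The value of `x` is the exponent of the power of `p` locally associated with it; it is unique
because `p` is not a local unit. -/
theorem exists_isLocVal {M : Set H} (hM : IsPrimeIdeal M) {p : H} (hp : p ∈ M) (hp0 : p ∉ zeroSet H)
    (h : ∀ x, x ∉ zeroSet H → ∃ n : ℕ, LDvd M x (p ^ n) ∧ LDvd M (p ^ n) x) :
    ∃ v, IsLocVal M v := by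
  have key : ∀ m n : ℕ, LDvd M (p ^ m) (p ^ n) → m ≤ n := by
    intro m n hmn
    by_contra! hlt
    obtain ⟨d, rfl⟩ := Nat.exists_eq_add_of_lt hlt
    obtain ⟨s, hs, e, he⟩ := hmn
    refine hs (hM.mem_of_dvd hp ⟨p ^ d * e, eq_of_mul_eq_mul (pow_notMem_zeroSet hp0 n) ?_⟩)
    rw [mul_comm, he, pow_succ, pow_add]; ac_rfl
  choose! v h1 h2 using h
  refine ⟨v, ⟨fun x y hx hy => ?_, fun x y hx hy => ?_, p, hp0, ?_⟩⟩
  · have hxy := mul_notMem_zeroSet hx hy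
    refine le_antisymm (key _ _ ?_) (key _ _ ?_)
    · rw [pow_add]
      exact hM.lDvd_trans (h2 _ hxy) (hM.lDvd_mul (h1 x hx) (h1 y hy))
    · rw [pow_add]
      exact hM.lDvd_trans (hM.lDvd_mul (h2 x hx) (h2 y hy)) (h1 _ hxy)
  · constructor
    · intro hle
      exact hM.lDvd_trans (h1 x hx) (hM.lDvd_trans (hM.lDvd_of_dvd (pow_dvd_pow p hle)) (h2 y hy))
    · intro hxy
      exact key _ _ (hM.lDvd_trans (h2 x hx) (hM.lDvd_trans hxy (h1 y hy)))
  · refine le_antisymm (key _ _ ?_) (key _ _ ?_)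
    · simpa using h2 p hp0
    · simpa using h1 p hp0

omit [IsNonzeroCancel H] in
/-- In a valuative situation `(x) ∩ (y)` is locally invertible. -/
theorem exists_invAt_inter {M : Set H} {x y : H} (hx : x ∉ zeroSet H) (hy : y ∉ zeroSet H)
    (h : LDvd M x y ∨ LDvd M y x) :
    ∃ a ∈ (sSystem H).cl {x} ∩ (sSystem H).cl {y},
      InvAt M ((sSystem H).cl {x} ∩ (sSystem H).cl {y}) a := by
  simp only [Set.mem_inter_iff, mem_sSystem_cl_singleton]
  rcases h with ⟨s, hs, h⟩ | ⟨s, hs, h⟩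
  · exact ⟨s * y, ⟨h, dvd_mul_left y s⟩, 1, y, s, hy, hs, by rw [one_mul, mul_comm],
      fun z hz => by rw [one_mul]; exact mem_sSystem_cl_singleton.1 hz.2⟩
  · exact ⟨s * x, ⟨dvd_mul_left x s, h⟩, 1, x, s, hx, hs, by rw [one_mul, mul_comm],
      fun z hz => by rw [one_mul]; exact mem_sSystem_cl_singleton.1 hz.1⟩

omit [IsNonzeroCancel H] in
theorem isIdeal_inter (r : FinIdealSystem H) {I J : Set H} (hI : r.IsIdeal I) (hJ : r.IsIdeal J) :
    r.IsIdeal (I ∩ J) :=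
  Set.Subset.antisymm (Set.subset_inter (hI.cl_subset Set.inter_subset_left)
    (hJ.cl_subset Set.inter_subset_right)) (r.subset_cl _)

theorem isFG_zeroSet : (wSystem H).IsFG (zeroSet H) :=
  ⟨wSystem_cl_empty (H := H) ▸ (wSystem H).isIdeal_cl ∅, ∅, Set.empty_subset _, Set.finite_empty,
    wSystem_cl_empty.symm⟩

omit [IsNonzeroCancel H] in
theorem inter_eq_zeroSet {x y : H} (h : x ∈ zeroSet H ∨ y ∈ zeroSet H) :
    (sSystem H).cl {x} ∩ (sSystem H).cl {y} = zeroSet H := by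
  ext u
  simp only [Set.mem_inter_iff, mem_sSystem_cl_singleton]
  refine ⟨fun hu => ?_, fun hu => ⟨dvd_of_mem_zeroSet hu _, dvd_of_mem_zeroSet hu _⟩⟩
  rcases h with h | h
  · exact mem_zeroSet_of_dvd h hu.1
  · exact mem_zeroSet_of_dvd h hu.2

/-- Locally `xH ∩ yH` is generated by whichever of `x`, `y` is the multiple of the other, so it is
invertible and therefore finitely generated. -/
theorem isFiniteConductor_of_lDvd_total
    (h : ∀ M, (tSystem H).IsMax M → ∀ x y, LDvd M x y ∨ LDvd M y x) :
    (wSystem H).IsFiniteConductor := by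
  intro x y
  by_cases hxy : x ∈ zeroSet H ∨ y ∈ zeroSet H
  · rw [inter_eq_zeroSet hxy]
    exact isFG_zeroSet
  · push Not at hxy
    exact isFG_of_invAt (isIdeal_inter _ ((wSystem H).isIdeal_singleton x)
      ((wSystem H).isIdeal_singleton y)) fun M hM => exists_invAt_inter hxy.1 hxy.2 (h M hM x y)

omit [IsNonzeroCancel H] in
theorem exists_lDvd_of_finite {M : Set H} (hM : IsPrimeIdeal M)
    (h : ∀ x y, LDvd M x y ∨ LDvd M y x) {E : Set H} (hE : E.Finite) (hne : E.Nonempty) :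
    ∃ e ∈ E, ∃ s, s ∉ M ∧ ∀ f ∈ E, e ∣ s * f := by
  induction E, hE using Set.Finite.induction_on with
  | empty => exact absurd hne Set.not_nonempty_empty
  | @insert a E _ _ ih =>
    rcases E.eq_empty_or_nonempty with rfl | hne'
    · exact ⟨a, by simp, 1, hM.one_notMem, by simp⟩
    · obtain ⟨e, he, s, hs, hdvd⟩ := ih hne'
      rcases h e a with ⟨t, ht, hea⟩ | ⟨t, ht, hae⟩
      · refine ⟨e, Set.mem_insert_of_mem _ he, t * s, hM.mul_notMem ht hs, ?_⟩
        rintro f (rfl | hf)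
        · rw [mul_right_comm]; exact hea.mul_right s
        · rw [mul_assoc]; exact (hdvd f hf).mul_left t
      · refine ⟨a, Set.mem_insert _ _, t * s, hM.mul_notMem ht hs, ?_⟩
        rintro f (rfl | hf)
        · exact dvd_mul_left _ _
        · rw [mul_assoc]; exact hae.trans (mul_dvd_mul_left t (hdvd f hf))

/-- If all localizations at `t`-maximal ideals are valuation monoids, then `t = w`. -/
theorem tSystem_cl_eq_wSystem_cl (hG : ¬ EqQuot H)
    (h : ∀ M, (tSystem H).IsMax M → ∀ x y, LDvd M x y ∨ LDvd M y x) (X : Set H) :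
    (tSystem H).cl X = (wSystem H).cl X := by
  refine Set.Subset.antisymm (Set.iUnion₂_subset fun E hE x hx => ?_) (wSystem_finer X)
  refine (wSystem H).cl_mono hE.1 (mem_wSystem_cl.2 fun M hM => ?_)
  have hP := hM.isPrime
  rcases E.eq_empty_or_nonempty with rfl | hne
  · exact ⟨1, hP.one_notMem, mem_sSystem_cl.2 (Or.inr (by
      rw [one_mul]; exact (vCl_zero (Set.empty_subset _)).subset hx))⟩
  · obtain ⟨e, he, s, hs, hdvd⟩ := exists_lDvd_of_finite hP (h M hM) hE.2 hne
    by_cases he0 : e ∈ zeroSet H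
    · have hE0 : E ⊆ zeroSet H := by
        intro f hf
        by_contra hf0
        exact mul_notMem_zeroSet (hP.notMem_zeroSet hs) hf0 (mem_zeroSet_of_dvd he0 (hdvd f hf))
      rw [vCl_zero hE0] at hx
      exact ⟨1, hP.one_notMem, mem_sSystem_cl.2 (Or.inr (by rwa [one_mul]))⟩
    · exact ⟨s, hs, mem_sSystem_cl.2 (Or.inl ⟨e, he, (mem_vCl_iff hG).1 hx s e he0 hdvd⟩)⟩

end Valuation

/-! ### Local consequences of factorizations into radical ideals. -/

section RadicalFactorization

variable {H : Type*} [CommMonoid H]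

theorem mem_list_prod_iff {L : List (Set H)} {q : H} :
    q ∈ L.prod ↔ ∃ l : List H, List.Forall₂ (fun i I => i ∈ I) l L ∧ l.prod = q := by
  induction L generalizing q with
  | nil => simp [eq_comm]
  | cons I L ih =>
    rw [List.prod_cons]
    constructor
    · rintro ⟨i, hi, q, hq, rfl⟩
      obtain ⟨l, hl, rfl⟩ := ih.1 hq
      exact ⟨i :: l, List.Forall₂.cons hi hl, List.prod_cons⟩
    · rintro ⟨_, h, rfl⟩
      cases h with
      | cons hi hl =>
        rw [List.prod_cons]
        exact ⟨_, hi, _, ih.2 ⟨_, hl, rfl⟩, rfl⟩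

/-- Replacing one factor `i` of a product by another element of its ideal stays inside the product
ideal; `c` is the product of the remaining factors. -/
theorem exists_cofactor {L : List (Set H)} {l : List H}
    (h : List.Forall₂ (fun i I => i ∈ I) l L) :
    ∀ i ∈ l, ∃ I ∈ L, i ∈ I ∧ ∃ c, c * i = l.prod ∧ ∀ y ∈ I, c * y ∈ L.prod := by
  induction h with
  | nil => simp
  | @cons j J l L hj hl ih =>
    intro i hi
    rcases List.mem_cons.1 hi with rfl | hi
    · refine ⟨J, List.mem_cons_self, hj, l.prod, by rw [List.prod_cons, mul_comm], fun y hy => ?_⟩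
      rw [List.prod_cons, mul_comm l.prod]
      exact ⟨y, hy, l.prod, mem_list_prod_iff.2 ⟨l, hl, rfl⟩, rfl⟩
    · obtain ⟨I, hI, hiI, c, hc, h⟩ := ih i hi
      refine ⟨I, List.mem_cons_of_mem _ hI, hiI, j * c, ?_, fun y hy => ?_⟩
      · rw [List.prod_cons, ← hc, mul_assoc]
      · rw [List.prod_cons, mul_assoc]
        exact ⟨j, hj, c * y, h y hy, rfl⟩

theorem list_prod_subset (r : FinIdealSystem H) {L : List (Set H)} {I : Set H} (hI : r.IsIdeal I)
    (hIL : I ∈ L) : L.prod ⊆ I := by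
  intro q hq
  obtain ⟨l, hl, rfl⟩ := mem_list_prod_iff.1 hq
  clear hq
  induction hl with
  | nil => simp at hIL
  | @cons j J l L hj hl ih =>
    rw [List.prod_cons]
    rcases List.mem_cons.1 hIL with rfl | h
    · exact hI.mem_of_dvd hj (dvd_mul_right _ _)
    · exact hI.mem_of_dvd (ih h) (dvd_mul_left _ _)

variable [IsNonzeroCancel H]

/-- `I` is a finite `w`-product of radical `w`-ideals. -/
def HasRadicalFactorization (I : Set H) : Prop :=
  ∃ L : List (Set H), (∀ J ∈ L, (wSystem H).IsIdeal J ∧ IsRadical J) ∧ (wSystem H).IsProd I L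

/-- An element that generates a radical ideal locally is locally radical. -/
theorem lRad_of_invAt {M I : Set H} (hM : IsPrimeIdeal M) (hI : (wSystem H).IsIdeal I)
    (hrad : IsRadical I) {i : H} (hi : i ∈ I) (h : InvAt M I i) : LRad M i := by
  rintro y n hn ⟨s, hs, hdvd⟩
  have h1 : s * y ∈ I := by
    rw [← hrad]
    refine ⟨n, hn, hI.mem_of_dvd hi ?_⟩
    obtain ⟨m, rfl⟩ : ∃ m, n = m + 1 := ⟨n - 1, by omega⟩
    rw [mul_pow, pow_succ s, mul_assoc]
    exact hdvd.mul_left _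
  exact hM.lDvd_of_lDvd_mul hs (h.lDvd h1)

/-- The factors of an invertible ideal are invertible: multiplication by the cofactor of `i` over
`x` maps the factor `I` into `H` and `i` outside `M`. -/
theorem exists_invAt_factorization {x : H} (hx : x ∉ zeroSet H) {L : List (Set H)}
    (hxL : (wSystem H).IsProd ((sSystem H).cl {x}) L) {M : Set H} (hM : (tSystem H).IsMax M) :
    ∃ l : List H, (∀ i ∈ l, ∃ I ∈ L, i ∈ I ∧ InvAt M I i) ∧ LDvd M l.prod x ∧ x ∣ l.prod := by
  have hP := hM.isPrime
  have hx1 : x ∈ (wSystem H).cl L.prod := hxL.subset (mem_sSystem_cl_singleton.2 dvd_rfl)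
  have hL : ∀ q ∈ L.prod, x ∣ q := fun q hq =>
    mem_sSystem_cl_singleton.1 (hxL.superset ((wSystem H).subset_cl _ hq))
  obtain ⟨s, hs, h⟩ := mem_wSystem_cl.1 hx1 M hM
  rcases mem_sSystem_cl.1 h with ⟨q, hq, e, he⟩ | h
  · obtain ⟨v, hv⟩ := hL q hq
    -- From `s * x = q * e` and `q = x * v` follows `s = v * e`.
    have hvM : v ∉ M := by
      refine hP.notMem_of_dvd ⟨e, ?_⟩ hs
      refine eq_of_mul_eq_mul hx ?_
      rw [mul_comm x s, he, hv, mul_assoc]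
    obtain ⟨l, hl, rfl⟩ := mem_list_prod_iff.1 hq
    refine ⟨l, fun i hi => ?_, ⟨s, hs, e, he⟩, v, hv⟩
    obtain ⟨I, hI, hiI, c, hc, h⟩ := exists_cofactor hl i hi
    exact ⟨I, hI, hiI, c, x, v, hx, hvM, by rw [hc, hv], fun y hy => hL _ (h y hy)⟩
  · exact absurd h (mul_notMem_zeroSet (hP.notMem_zeroSet hs) hx)

theorem exists_lRad_factorization {x : H} (hx : x ∉ zeroSet H)
    (hF : HasRadicalFactorization ((sSystem H).cl {x})) {M : Set H} (hM : (tSystem H).IsMax M) :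
    ∃ l : List H, (∀ i ∈ l, LRad M i ∧ i ∉ zeroSet H) ∧ LDvd M l.prod x ∧ LDvd M x l.prod := by
  have hP := hM.isPrime
  obtain ⟨L, hL, hprod⟩ := hF
  obtain ⟨l, hl, h1, h2⟩ := exists_invAt_factorization hx hprod hM
  refine ⟨l, fun i hi => ⟨?_, ?_⟩, h1, hP.lDvd_of_dvd h2⟩
  · obtain ⟨I, hI, hiI, hinv⟩ := hl i hi
    exact lRad_of_invAt hP (hL I hI).1 (hL I hI).2 hiI hinv
  · exact notMem_zeroSet_of_dvd (List.dvd_prod hi) (hP.notMem_zeroSet_of_lDvd h1 hx)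

/-- Suppose `s * a = b * c`. If `c` is outside `M`, then `a` divides `b` locally. If `c ∈ M`,
comparing `c` with `a` and `b` shows that `c²` or `b²` divides `a` locally, or that `b` is a local
unit; each is impossible. By symmetry, locally radical nonzero elements of `M` are associated. -/
theorem lDvd_of_lRad {M : Set H} (hM : IsPrimeIdeal M)
    (hcmp : ∀ a ∈ M, ∀ b ∈ M, a ∉ zeroSet H → b ∉ zeroSet H → LRad M b →
      LDvd M a b ∨ LDvd M b a) {a b : H} (ha : a ∈ M) (hb : b ∈ M) (ha0 : a ∉ zeroSet H)
    (hb0 : b ∉ zeroSet H) (hra : LRad M a) (hrb : LRad M b) : LDvd M a b := by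
  rcases hcmp a ha b hb ha0 hb0 hrb with h | ⟨s, hs, c, hc⟩
  · exact h
  · by_cases hcM : c ∈ M
    · have hc0 : c ∉ zeroSet H := notMem_zeroSet_of_dvd (y := s * a) ⟨b, by rw [hc, mul_comm]⟩
        (mul_notMem_zeroSet (hM.notMem_zeroSet hs) ha0)
      rcases hcmp c hcM a ha hc0 ha0 hra with h | h
      · rcases hcmp c hcM b hb hc0 hb0 hrb with h | h
        · refine absurd (hM.lDvd_of_lDvd_mul hs ?_) (hM.not_sq_lDvd hcM ha0 hra)
          rw [hc]
          exact hM.lDvd_mul h (hM.lDvd_refl c)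
        · refine absurd (hM.lDvd_of_lDvd_mul hs ?_) (hM.not_sq_lDvd hb ha0 hra)
          rw [hc]
          exact hM.lDvd_mul (hM.lDvd_refl b) h
      · have h1 : LDvd M (a * b) (s * a) := by
          rw [hc, mul_comm b c]
          exact hM.lDvd_mul h (hM.lDvd_refl b)
        obtain ⟨t, ht, w, hw⟩ := h1
        refine absurd (hM.mem_of_dvd hb ⟨w, ?_⟩) (hM.mul_notMem ht hs)
        refine eq_of_mul_eq_mul ha0 ?_
        rw [← mul_assoc a b, ← hw]; ac_rfl
    · exact ⟨c, hcM, s, by rw [mul_comm c b, ← hc, mul_comm]⟩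

/-- If elements of `M` are locally comparable to radical elements, then the localization at `M` is
a discrete valuation monoid. -/
theorem exists_isLocVal_of_comparable (hG : ¬ EqQuot H) {M : Set H} (hM : (tSystem H).IsMax M)
    (hF : ∀ x : H, x ∉ zeroSet H → HasRadicalFactorization ((sSystem H).cl {x}))
    (hcmp : ∀ a ∈ M, ∀ b ∈ M, a ∉ zeroSet H → b ∉ zeroSet H → LRad M b →
      LDvd M a b ∨ LDvd M b a) : ∃ v, IsLocVal M v := by
  have hP := hM.isPrime
  obtain ⟨x, hxM, hx⟩ := isMax_exists_notMem_zeroSet hG hM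
  obtain ⟨l, hl, -, h2⟩ := exists_lRad_factorization hx (hF x hx) hM
  obtain ⟨p, hpl, hp⟩ := hP.exists_mem_of_prod_mem (hP.mem_of_lDvd hxM h2)
  obtain ⟨hpr, hp0⟩ := hl p hpl
  refine exists_isLocVal hP hp hp0 fun y hy => ?_
  obtain ⟨l, hl, h1, h2⟩ := exists_lRad_factorization hy (hF y hy) hM
  have key : ∃ n : ℕ, LDvd M l.prod (p ^ n) ∧ LDvd M (p ^ n) l.prod := by
    clear h1 h2
    induction l with
    | nil => exact ⟨0, by simpa using hP.lDvd_refl 1, by simpa using hP.lDvd_refl 1⟩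
    | cons i l ih =>
      obtain ⟨n, h1, h2⟩ := ih fun j hj => hl j (List.mem_cons_of_mem _ hj)
      obtain ⟨hir, hi0⟩ := hl i List.mem_cons_self
      simp only [List.prod_cons]
      by_cases hi : i ∈ M
      · refine ⟨n + 1, ?_, ?_⟩
        · rw [pow_succ']
          exact hP.lDvd_mul (lDvd_of_lRad hP hcmp hi hp hi0 hp0 hir hpr) h1
        · rw [pow_succ']
          exact hP.lDvd_mul (lDvd_of_lRad hP hcmp hp hi hp0 hi0 hpr hir) h2
      · refine ⟨n, ?_, hP.lDvd_trans h2 (hP.lDvd_of_dvd (dvd_mul_left _ _))⟩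
        simpa using hP.lDvd_mul (lDvd_of_notMem hi 1) h1
  obtain ⟨n, h3, h4⟩ := key
  exact ⟨n, hP.lDvd_trans h2 h3, hP.lDvd_trans h4 h1⟩

/-- Contractions to `H` of ideals of the localization at `M` are `w`-ideals. -/
theorem wSystem_isIdeal_setOf {M : Set H} (hM : (tSystem H).IsMax M) {p : H → Prop}
    (hp : ∀ s x, s ∉ M → p (s * x) → p x) (hdvd : ∀ x y, p x → x ∣ y → p y)
    (hz : ∀ x ∈ zeroSet H, p x) : (wSystem H).IsIdeal {x | p x} := by
  refine Set.Subset.antisymm (fun x hx => ?_) ((wSystem H).subset_cl _)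
  obtain ⟨s, hs, h⟩ := mem_wSystem_cl.1 hx M hM
  refine hp s x hs ?_
  rcases mem_sSystem_cl.1 h with ⟨a, ha, h⟩ | h
  · exact hdvd a _ ha h
  · exact hz _ h

/-- If all `w`-ideals factor into radical ones, then elements are locally comparable to radical
elements: factor the ideal that is locally generated by `a²` and `b`. -/
theorem lDvd_or_of_hasRadicalFactorization
    (hF : ∀ I : Set H, (wSystem H).IsIdeal I → HasRadicalFactorization I) {M : Set H}
    (hM : (tSystem H).IsMax M) {a b : H} (hb : b ∈ M) (ha0 : a ∉ zeroSet H)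
    (hb0 : b ∉ zeroSet H) (hrb : LRad M b) : LDvd M a b ∨ LDvd M b a := by
  have hP := hM.isPrime
  by_contra! hab
  set J : Set H := {x | LDvd M (a ^ 2) x ∨ LDvd M b x}
  have hJ : (wSystem H).IsIdeal J := wSystem_isIdeal_setOf hM
    (fun s x hs h => h.imp (hP.lDvd_of_lDvd_mul hs) (hP.lDvd_of_lDvd_mul hs))
    (fun x y h hxy => h.imp (fun h => hP.lDvd_trans h (hP.lDvd_of_dvd hxy))
      (fun h => hP.lDvd_trans h (hP.lDvd_of_dvd hxy)))
    (fun x hx => Or.inr (hP.lDvd_of_dvd (dvd_of_mem_zeroSet hx b)))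
  obtain ⟨L, hL, hprod⟩ := hF J hJ
  have hLJ : L.prod ⊆ J := ((wSystem H).subset_cl _).trans hprod.superset
  -- Every factor contains `J`, hence `a²`, and is radical.
  have haL : ∀ I ∈ L, a ∈ I := by
    intro I hI
    rw [← (hL I hI).2]
    refine ⟨2, two_pos, ?_⟩
    have h1 : J ⊆ I := hprod.subset.trans
      ((hL I hI).1.cl_subset (list_prod_subset _ (hL I hI).1 hI))
    exact h1 (Or.inl (hP.lDvd_refl _))
  have hbJ : b ∈ (wSystem H).cl L.prod := hprod.subset (Or.inr (hP.lDvd_refl b))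
  obtain ⟨s, hs, h⟩ := mem_wSystem_cl.1 hbJ M hM
  rcases mem_sSystem_cl.1 h with ⟨q, hq, hqb⟩ | h
  swap
  · exact mul_notMem_zeroSet (hP.notMem_zeroSet hs) hb0 h
  have hqb' : LDvd M q b := ⟨s, hs, hqb⟩
  have hq0 := hP.notMem_zeroSet_of_lDvd hqb' hb0
  have hqJ := hLJ hq
  obtain ⟨l, hl, rfl⟩ := mem_list_prod_iff.1 hq
  -- For the cofactor `c` of `i` in `q`, the element `c * a` lies in `J`. If `a²` divides it
  -- locally, then `a ∣ c ∣ q ∣ b` locally, which is excluded. So `b`, and with it `q = c * i`,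
  -- divides `c * a` locally; cancel `c`.
  have hla : ∀ i ∈ l, LDvd M i a := by
    intro i hi
    obtain ⟨I, hI, hiI, c, hc, h⟩ := exists_cofactor hl i hi
    have hc0 : c ∉ zeroSet H := notMem_zeroSet_of_dvd ⟨i, hc.symm⟩ hq0
    rcases hLJ (h a (haL I hI)) with ⟨t, ht, h⟩ | ⟨t, ht, h⟩
    · have h1 : a ∣ t * c := dvd_of_mul_dvd_mul ha0 (by
        rw [sq] at h; convert h using 1; ac_rfl)
      refine absurd (hP.lDvd_trans ⟨t, ht, ?_⟩ hqb') hab.1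
      rw [← hc, ← mul_assoc]
      exact h1.mul_right i
    · refine ⟨s * t, hP.mul_notMem hs ht, dvd_of_mul_dvd_mul hc0 ?_⟩
      rw [hc]
      refine hqb.trans ((mul_dvd_mul_left s h).trans (Eq.dvd ?_))
      ac_rfl
  have hqa : ∃ n : ℕ, LDvd M l.prod (a ^ n) := by
    clear hl hq hqb hqb' hq0 hqJ
    induction l with
    | nil => exact ⟨0, by simpa using hP.lDvd_refl 1⟩
    | cons i l ih =>
      obtain ⟨n, h⟩ := ih fun j hj => hla j (List.mem_cons_of_mem _ hj)
      refine ⟨n + 1, ?_⟩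
      rw [List.prod_cons, pow_succ']
      exact hP.lDvd_mul (hla i List.mem_cons_self) h
  obtain ⟨n, hn⟩ := hqa
  -- As `q ∈ J`, either `a²` divides `q`, hence `b`, locally, or `b` divides `q`, hence `a ^ n`, and
  -- is locally radical. Both contradict `hab`.
  rcases hqJ with h | h
  · exact hab.1 (hP.lDvd_trans (hP.lDvd_of_dvd (dvd_pow_self a two_ne_zero))
      (hP.lDvd_trans h hqb'))
  · have h1 := hP.lDvd_trans h hn
    rcases Nat.eq_zero_or_pos n with rfl | hn0
    · rw [pow_zero] at h1
      exact hP.one_notMem (hP.mem_of_lDvd hb h1)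
    · exact hab.2 (hrb a n hn0 h1)

/-- Radical factorizations of principal ideals, together with discrete local valuations, make the
radicals of principal ideals locally invertible. -/
theorem exists_invAt_rad
    (hF : ∀ x : H, x ∉ zeroSet H → HasRadicalFactorization ((sSystem H).cl {x}))
    (hv : ∀ M, (tSystem H).IsMax M → ∃ v, IsLocVal M v) (x : H) (hx : x ∉ zeroSet H) (M : Set H)
    (hM : (tSystem H).IsMax M) :
    ∃ a ∈ rad ((sSystem H).cl {x}), InvAt M (rad ((sSystem H).cl {x})) a := by
  have hP := hM.isPrime
  by_cases hxM : x ∈ M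
  swap
  · exact ⟨x, ⟨1, one_pos, by rw [pow_one]; exact mem_sSystem_cl_singleton.2 dvd_rfl⟩, 1, 1, x,
      one_notMem_zeroSet, hxM, rfl, fun y _ => one_dvd _⟩
  obtain ⟨v, hv⟩ := hv M hM
  obtain ⟨L, hL, hprod⟩ := hF x hx
  obtain ⟨l, hl, h1, h2⟩ := exists_invAt_factorization hx hprod hM
  obtain ⟨i, hil, hi⟩ := hP.exists_mem_of_prod_mem (hP.mem_of_dvd hxM h2)
  obtain ⟨I, hI, hiI, c, d, u, hd, hu, hca, h⟩ := hl i hil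
  have hi0 := notMem_zeroSet_of_dvd (List.dvd_prod hil) (hP.notMem_zeroSet_of_lDvd h1 hx)
  -- Since `i ∈ M` has value at least 1, `x` divides a power of `i` locally, and a multiple `s * i`
  -- with `s ∉ M` lies in the radical of `xH`. That radical is contained in the radical ideal `I`,
  -- so the fraction `c / d` that works for `I` works for it too.
  have hle : v x ≤ v (i ^ (v x + 1)) := by
    rw [hv.pow hi0]
    have : v i ≠ 0 := fun h => (hv.eq_zero_iff hP hi0).1 h hi
    have : 1 ≤ v i := by omega
    nlinarith
  obtain ⟨s, hs, hdvd⟩ := (hv.le_iff _ _ hx (pow_notMem_zeroSet hi0 _)).1 hle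
  refine ⟨s * i, ⟨v x + 1, Nat.succ_pos _, mem_sSystem_cl_singleton.2 ?_⟩, c, d, s * u, hd,
    hP.mul_notMem hs hu, ?_, fun y hy => h y ?_⟩
  · rw [mul_pow, pow_succ s, mul_assoc]
    exact hdvd.mul_left _
  · rw [mul_left_comm, hca, mul_left_comm]
  · rw [← (hL I hI).2]
    obtain ⟨n, hn, hy⟩ := hy
    refine ⟨n, hn, ?_⟩
    exact (hL I hI).1.cl_subset (list_prod_subset _ (hL I hI).1 hI) (hprod.subset hy)

end RadicalFactorization

/-! ### From invertible radicals of principal ideals to discrete local valuations. -/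

section RadicalsOfPrincipalIdeals

variable {H : Type*} [CommMonoid H]

theorem mem_rad_of_dvd_pow {x y : H} {n : ℕ} (hn : 0 < n) (h : x ∣ y ^ n) :
    y ∈ rad ((sSystem H).cl {x}) := ⟨n, hn, mem_sSystem_cl_singleton.2 h⟩

theorem self_mem_rad (x : H) : x ∈ rad ((sSystem H).cl {x}) :=
  mem_rad_of_dvd_pow one_pos (by rw [pow_one])

theorem mem_of_mem_rad {M : Set H} (hM : IsPrimeIdeal M) {x y : H} (hx : x ∈ M)
    (hy : y ∈ rad ((sSystem H).cl {x})) : y ∈ M := by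
  obtain ⟨n, -, h⟩ := hy
  exact hM.mem_of_pow_mem (hM.mem_of_dvd hx (mem_sSystem_cl_singleton.1 h))

theorem isRadical_rad (X : Set H) : IsRadical (rad X) := by
  refine Set.Subset.antisymm ?_ fun x hx => ⟨1, one_pos, by rwa [pow_one]⟩
  rintro x ⟨n, hn, m, hm, h⟩
  exact ⟨n * m, Nat.mul_pos hn hm, by rwa [pow_mul]⟩

variable [IsNonzeroCancel H]

/-- If radicals of principal ideals are locally invertible, then the localizations at
`t`-maximal ideals are discrete valuation monoids. -/
theorem exists_isLocVal_of_invAt_rad (hG : ¬ EqQuot H)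
    (hR : ∀ x : H, x ∉ zeroSet H → ∀ M, (tSystem H).IsMax M →
      ∃ a ∈ rad ((sSystem H).cl {x}), InvAt M (rad ((sSystem H).cl {x})) a)
    (M : Set H) (hM : (tSystem H).IsMax M) : ∃ v, IsLocVal M v := by
  have hP := hM.isPrime
  have hgen : ∀ x, x ∉ zeroSet H → x ∈ M → ∃ j, j ∈ rad ((sSystem H).cl {x}) ∧ j ∈ M ∧
      j ∉ zeroSet H ∧ LRad M j ∧ InvAt M (rad ((sSystem H).cl {x})) j := by
    intro x hx hxM
    obtain ⟨j, hj, hinv⟩ := hR x hx M hM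
    exact ⟨j, hj, mem_of_mem_rad hP hxM hj,
      hP.notMem_zeroSet_of_lDvd (hinv.lDvd (self_mem_rad x)) hx,
      lRad_of_invAt hP ((wSystem H).isIdeal_singleton x).rad (isRadical_rad _) hj hinv, hinv⟩
  -- Let `l` generate the radical of `(j * k)` locally; both `j` and `k` divide it locally. Write `s
  -- * l = k * a`. If `a ∈ M`, then `k * a` is locally radical, so the radical of `(k * a)` is an
  -- invertible ideal containing `kH ∩ aH` and lying locally in `(k * a)`, which is impossible. So
  -- `a ∉ M`, and `j ∣ l ∣ k` locally.
  have hcmp : ∀ j ∈ M, ∀ k ∈ M, j ∉ zeroSet H → k ∉ zeroSet H → LRad M j → LRad M k →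
      LDvd M j k := by
    intro j hj k hk hj0 hk0 hjr hkr
    obtain ⟨l, hl, hlM, hl0, hlr, hinv⟩ := hgen (j * k) (mul_notMem_zeroSet hj0 hk0)
      (hP.mem_of_dvd hj (dvd_mul_right _ _))
    obtain ⟨n, hn, hn'⟩ := hl
    have hdvd := mem_sSystem_cl_singleton.1 hn'
    have hjl : LDvd M j l := hjr l n hn (hP.lDvd_of_dvd ((dvd_mul_right j k).trans hdvd))
    have hkl : LDvd M k l := hkr l n hn (hP.lDvd_of_dvd ((dvd_mul_left k j).trans hdvd))
    obtain ⟨s, hs, a, ha⟩ := hkl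
    have haM : a ∉ M := by
      intro haM
      have ha0 : a ∉ zeroSet H := notMem_zeroSet_of_dvd ⟨k, by rw [ha, mul_comm]⟩
        (mul_notMem_zeroSet (hP.notMem_zeroSet hs) hl0)
      have hr : LRad M (k * a) := ha ▸ hP.lRad_mul hs hlr
      obtain ⟨b, hb, hbinv⟩ := hR (k * a) (mul_notMem_zeroSet hk0 ha0) M hM
      refine not_invAt_of_lDvd_mul hG hM hk haM hk0 ha0 (fun y hky hay => ?_) (fun y hy => ?_)
        hb hbinv
      · exact mem_rad_of_dvd_pow two_pos (by rw [sq]; exact mul_dvd_mul hky hay)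
      · obtain ⟨m, hm, h⟩ := hy
        exact hr y m hm (hP.lDvd_of_dvd (mem_sSystem_cl_singleton.1 h))
    refine hP.lDvd_trans hjl ⟨a, haM, s, ?_⟩
    rw [mul_comm a, ← ha, mul_comm]
  obtain ⟨x, hxM, hx⟩ := isMax_exists_notMem_zeroSet hG hM
  obtain ⟨p, -, hpM, hp0, hpr, -⟩ := hgen x hx hxM
  have hmain : ∀ y ∈ M, y ∉ zeroSet H → LDvd M p y ∧ ∃ n : ℕ, LDvd M y (p ^ n) := by
    intro y hy hy0
    obtain ⟨k, ⟨n, hn, hk⟩, hkM, hk0, hkr, hkinv⟩ := hgen y hy0 hy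
    refine ⟨hP.lDvd_trans (hcmp p hpM k hkM hp0 hk0 hpr hkr) (hkinv.lDvd (self_mem_rad y)), n, ?_⟩
    exact hP.lDvd_trans (hP.lDvd_of_dvd (mem_sSystem_cl_singleton.1 hk))
      (hP.lDvd_pow (hcmp k hkM p hpM hk0 hp0 hkr hpr) n)
  -- A local divisor of `p ^ n` in `M` is divisible by `p`, so `p` can be cancelled and the exponent
  -- drops.
  have key : ∀ n : ℕ, ∀ y, y ∉ zeroSet H → LDvd M y (p ^ n) →
      ∃ m : ℕ, LDvd M y (p ^ m) ∧ LDvd M (p ^ m) y := by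
    intro n
    induction n with
    | zero =>
      intro y hy h
      exact ⟨0, h, hP.lDvd_of_dvd (by simp)⟩
    | succ n ih =>
      intro y hy h
      by_cases hyM : y ∈ M
      · obtain ⟨s, hs, y', hy'⟩ := (hmain y hyM hy).1
        have hy'0 : y' ∉ zeroSet H := notMem_zeroSet_of_dvd ⟨p, by rw [hy', mul_comm]⟩
          (mul_notMem_zeroSet (hP.notMem_zeroSet hs) hy)
        obtain ⟨t, ht, e, he⟩ := h
        obtain ⟨m, h1, h2⟩ := ih y' hy'0 ⟨s * t, hP.mul_notMem hs ht, e, by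
          refine eq_of_mul_eq_mul hp0 ?_
          calc p * (s * t * p ^ n) = s * (t * p ^ (n + 1)) := by rw [pow_succ]; ac_rfl
            _ = s * y * e := by rw [he, mul_assoc]
            _ = p * (y' * e) := by rw [hy', mul_assoc]⟩
        refine ⟨m + 1, ?_, hP.lDvd_of_lDvd_mul hs ?_⟩
        · refine hP.lDvd_trans (hP.lDvd_of_dvd (dvd_mul_left y s)) ?_
          rw [hy', pow_succ, mul_comm p]
          exact hP.lDvd_mul h1 (hP.lDvd_refl p)
        · rw [hy', pow_succ']
          exact hP.lDvd_mul (hP.lDvd_refl p) h2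
      · exact ⟨0, lDvd_of_notMem hyM _, hP.lDvd_of_dvd (by simp)⟩
  refine exists_isLocVal hP hpM hp0 fun y hy => ?_
  by_cases hyM : y ∈ M
  · obtain ⟨n, hn⟩ := (hmain y hyM hy).2
    exact key n y hy hn
  · exact ⟨0, lDvd_of_notMem hyM _, hP.lDvd_of_dvd (by simp)⟩

namespace IsLocVal

/-- A uniformizer `p` satisfies `x ∣ p ^ v x` locally; multiplying it by a suitable element outside
`M` makes `x` divide a power globally without changing the value. -/
theorem exists_mem_rad_eq_one {M : Set H} {v : H → ℕ} (hv : IsLocVal M v) (hM : IsPrimeIdeal M)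
    {x : H} (hx : x ∉ zeroSet H) (hxM : x ∈ M) :
    ∃ j ∈ rad ((sSystem H).cl {x}), j ∉ zeroSet H ∧ v j = 1 := by
  obtain ⟨p, hp, hp1⟩ := hv.exists_eq_one
  have hpos : 0 < v x := Nat.pos_of_ne_zero fun h => (hv.eq_zero_iff hM hx).1 h hxM
  obtain ⟨s, hs, h⟩ := (hv.le_iff x (p ^ v x) hx (pow_notMem_zeroSet hp _)).1
    (by rw [hv.pow hp, hp1, mul_one])
  refine ⟨s * p, mem_rad_of_dvd_pow hpos ?_, mul_notMem_zeroSet (hM.notMem_zeroSet hs) hp, ?_⟩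
  · obtain ⟨m, hm⟩ : ∃ m, v x = m + 1 := ⟨v x - 1, by omega⟩
    rw [hm] at h ⊢
    rw [mul_pow, pow_succ s, mul_assoc]
    exact h.mul_left _
  · rw [hv.mul _ _ (hM.notMem_zeroSet hs) hp, (hv.eq_zero_iff hM (hM.notMem_zeroSet hs)).2 hs, hp1]

end IsLocVal

/-! ### Boundedness and semicontinuity of the values; comparable factorizations. -/

variable {v : Set H → H → ℕ} (hv : ∀ M, (tSystem H).IsMax M → IsLocVal M (v M))
  (hR : ∀ x : H, x ∉ zeroSet H → ∀ M, (tSystem H).IsMax M →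
    ∃ a ∈ rad ((sSystem H).cl {x}), InvAt M (rad ((sSystem H).cl {x})) a)
include hv hR

/-- The radical of `xH` has finitely many generators `e`, and `x` divides `e ^ N` for a common `N`.
At each `M` containing `x` the radical has an element of value 1, so some generator has value at
most 1, whence `v M x ≤ N`. -/
theorem exists_val_bound {x : H} (hx : x ∉ zeroSet H) :
    ∃ n, ∀ M, (tSystem H).IsMax M → v M x ≤ n := by
  obtain ⟨-, E, hE, hfin, hEq⟩ := isFG_of_invAt ((wSystem H).isIdeal_singleton x).rad (hR x hx)
  have hE' : ∀ e ∈ E, ∃ n : ℕ, x ∣ e ^ n := fun e he => by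
    obtain ⟨n, -, h⟩ := hE he
    exact ⟨n, mem_sSystem_cl_singleton.1 h⟩
  choose! k hk using hE'
  obtain ⟨N, hN⟩ := (hfin.image k).bddAbove
  refine ⟨N, fun M hM => ?_⟩
  have hP := hM.isPrime
  by_cases hxM : x ∈ M
  · obtain ⟨j, hj, hj0, hj1⟩ := (hv M hM).exists_mem_rad_eq_one hP hx hxM
    rw [hEq] at hj
    obtain ⟨s, hs, h⟩ := mem_wSystem_cl.1 hj M hM
    have hsj := mul_notMem_zeroSet (hP.notMem_zeroSet hs) hj0
    rcases mem_sSystem_cl.1 h with ⟨e, he, h⟩ | h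
    · have he0 := notMem_zeroSet_of_dvd h hsj
      have h1 : v M e ≤ 1 := by
        rw [← hj1]
        exact ((hv M hM).le_iff _ _ he0 hj0).2 ⟨s, hs, h⟩
      calc v M x ≤ v M (e ^ N) := (hv M hM).le_of_dvd hP (pow_notMem_zeroSet he0 N)
            ((hk e he).trans (pow_dvd_pow e (hN ⟨e, he, rfl⟩)))
        _ = N * v M e := (hv M hM).pow he0 N
        _ ≤ N * 1 := Nat.mul_le_mul_left N h1
        _ = N := mul_one N
    · exact absurd h hsj
  · rw [((hv M hM).eq_zero_iff hP hx).2 hxM]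
    exact Nat.zero_le N

/-- The set of `t`-maximal ideals at which `z` has value at least `k` is closed. -/
theorem exists_notMem_of_val_lt {M : Set H} (hM : (tSystem H).IsMax M) (m : ℕ) :
    ∀ z, z ∉ zeroSet H → v M z = m → ∀ k, m < k →
      ∃ y, y ∉ M ∧ ∀ M', (tSystem H).IsMax M' → k ≤ v M' z → y ∈ M' := by
  have hP := hM.isPrime
  induction m with
  | zero =>
    intro z hz hm k hk
    refine ⟨z, ((hv M hM).eq_zero_iff hP hz).1 hm, fun M' hM' hle => ?_⟩
    by_contra hzM
    have := ((hv M' hM').eq_zero_iff hM'.isPrime hz).2 hzM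
    omega
  | succ m ih =>
    intro z hz hm k hk
    have hzM : z ∈ M := by
      by_contra hzM
      have := ((hv M hM).eq_zero_iff hP hz).2 hzM
      omega
    obtain ⟨a, ha, hinv⟩ := hR z hz M hM
    have ha0 := hP.notMem_zeroSet_of_lDvd (hinv.lDvd (self_mem_rad z)) hz
    have haM := mem_of_mem_rad hP hzM ha
    have ha1 : v M a = 1 := by
      obtain ⟨j, hj, hj0, hj1⟩ := (hv M hM).exists_mem_rad_eq_one hP hz hzM
      have h1 := ((hv M hM).le_iff a j ha0 hj0).2 (hinv.lDvd hj)
      have h2 : v M a ≠ 0 := fun h => ((hv M hM).eq_zero_iff hP ha0).1 h haM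
      omega
    obtain ⟨c, d, u, hd, hu, hca, hdvd⟩ := hinv
    have hu0 := hP.notMem_zeroSet hu
    have hc0 : c ∉ zeroSet H := notMem_zeroSet_of_dvd ⟨a, hca.symm⟩ (mul_notMem_zeroSet hd hu0)
    -- The element `z1 = (c/d) * z` is `z` divided by its radical: its value at `M` is one less than
    -- that of `z`, while at any `M'` containing `z` it is smaller by at most one. Hence induction
    -- applies with `k - 1`.
    obtain ⟨z1, hz1⟩ := hdvd z (self_mem_rad z)
    have hz10 : z1 ∉ zeroSet H := notMem_zeroSet_of_dvd ⟨d, by rw [hz1, mul_comm]⟩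
      (mul_notMem_zeroSet hc0 hz)
    have hval : ∀ M', (tSystem H).IsMax M' → v M' c + v M' z = v M' d + v M' z1 := by
      intro M' hM'
      rw [← (hv M' hM').mul _ _ hc0 hz, hz1, (hv M' hM').mul _ _ hd hz10]
    have h1 : v M c + v M a = v M d + v M u := by
      rw [← (hv M hM).mul _ _ hc0 ha0, hca, (hv M hM).mul _ _ hd hu0]
    rw [((hv M hM).eq_zero_iff hP hu0).2 hu] at h1
    have h2 := hval M hM
    obtain ⟨y, hyM, hy⟩ := ih z1 hz10 (by omega) (k - 1) (by omega)
    refine ⟨y, hyM, fun M' hM' hle => hy M' hM' ?_⟩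
    have hzM' : z ∈ M' := by
      by_contra hzM'
      have := ((hv M' hM').eq_zero_iff hM'.isPrime hz).2 hzM'
      omega
    obtain ⟨j, hj, hj0, hj1⟩ := (hv M' hM').exists_mem_rad_eq_one hM'.isPrime hz hzM'
    have h3 := (hv M' hM').le_of_dvd hM'.isPrime (mul_notMem_zeroSet hc0 hj0) (hdvd j hj)
    rw [(hv M' hM').mul _ _ hc0 hj0] at h3
    have h4 := hval M' hM'
    omega

/-- The radical ideals in the factorization of an ideal `I` are the intersections of the
`t`-maximal ideals at which `I` has value greater than `k`, for `k = 0, 1, 2, …`. -/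
theorem exists_comparable_factorization {I : Set H} (hI : (wSystem H).IsIdeal I) :
    ∃ L : List (Set H), (∀ J ∈ L, (wSystem H).IsIdeal J ∧ IsRadical J) ∧
      (∀ J ∈ L, ∀ K ∈ L, J ⊆ K ∨ K ⊆ J) ∧ (wSystem H).IsProd I L := by
  by_cases hI0 : I ⊆ zeroSet H
  · have hIz : I = zeroSet H := Set.Subset.antisymm hI0 hI.zeroSet_subset
    refine ⟨[I], by simpa using ⟨hI, hIz ▸ isRadical_zeroSet⟩, by simp, ?_⟩
    rw [FinIdealSystem.IsProd, List.prod_singleton]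
    exact hI.symm
  obtain ⟨x, hxI, hx⟩ := Set.not_subset.1 hI0
  -- The element `i M` realizes the local value `v_M(I)` of the ideal.
  have hmin : ∀ M : Set H, ∃ i, i ∈ I ∧ i ∉ zeroSet H ∧
      ∀ y ∈ I, y ∉ zeroSet H → v M i ≤ v M y := by
    intro M
    have hne : (v M '' {y | y ∈ I ∧ y ∉ zeroSet H}).Nonempty := ⟨_, x, ⟨hxI, hx⟩, rfl⟩
    obtain ⟨i, ⟨hi, hi0⟩, hii⟩ := Nat.sInf_mem hne
    refine ⟨i, hi, hi0, fun y hy hy0 => ?_⟩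
    rw [hii]
    exact Nat.sInf_le ⟨y, ⟨hy, hy0⟩, rfl⟩
  choose i hiI hi0 hile using hmin
  obtain ⟨n, hn⟩ := exists_val_bound hv hR hx
  set K : ℕ → Set H := fun k => {y | ∀ M, (tSystem H).IsMax M → k < v M (i M) → y ∈ M}
  have hKmem : ∀ k y, y ∈ K k ↔ ∀ M, (tSystem H).IsMax M → k < v M (i M) → y ∈ M :=
    fun k y => Iff.rfl
  have hKmono : ∀ k l, k ≤ l → K k ⊆ K l := fun k l hkl y hy M hM h =>
    (hKmem k y).1 hy M hM (by omega)
  have hKideal : ∀ k, (wSystem H).IsIdeal (K k) := by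
    intro k
    refine Set.Subset.antisymm (fun y hy M hM hk => ?_) ((wSystem H).subset_cl _)
    exact (wSystem_isIdeal_of_tSystem hM.1.1).cl_subset (fun y hy => (hKmem k y).1 hy M hM hk) hy
  have hKrad : ∀ k, IsRadical (K k) := by
    intro k
    refine Set.Subset.antisymm ?_ fun y hy => ⟨1, one_pos, by rwa [pow_one]⟩
    rintro y ⟨m, -, hy⟩ M hM hk
    exact hM.isPrime.mem_of_pow_mem (hy M hM hk)
  -- The product of `K 0, …, K (k - 1)` has local value `min k (v_M(I))`: the factor `K k` has value
  -- 1 at `M` if `k < v_M(I)` and 0 otherwise.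
  have hprod : ∀ M, (tSystem H).IsMax M → ∀ k : ℕ,
      (∀ y ∈ ((List.range k).map K).prod, y ∉ zeroSet H → min k (v M (i M)) ≤ v M y) ∧
      ∃ y ∈ ((List.range k).map K).prod, y ∉ zeroSet H ∧ v M y = min k (v M (i M)) := by
    intro M hM k
    have hP := hM.isPrime
    have hvM := hv M hM
    induction k with
    | zero =>
      refine ⟨by simp, 1, by simp, one_notMem_zeroSet, ?_⟩
      rw [hvM.one]; simp
    | succ k ih =>
      obtain ⟨ih1, q, hq, hq0, hqv⟩ := ih
      rw [List.range_succ, List.map_append, List.prod_append, List.map_singleton,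
        List.prod_singleton]
      constructor
      · rintro _ ⟨y, hy, y', hy', rfl⟩ h0
        have hy0 := notMem_zeroSet_of_dvd (dvd_mul_right y y') h0
        have hy'0 := notMem_zeroSet_of_dvd (dvd_mul_left y' y) h0
        have h1 := ih1 y hy hy0
        have h2 := hvM.mul y y' hy0 hy'0
        simp only at h2 ⊢
        by_cases hk : k < v M (i M)
        · have h3 : v M y' ≠ 0 := fun h => (hvM.eq_zero_iff hP hy'0).1 h (hy' M hM hk)
          omega
        · omega
      · by_cases hk : k < v M (i M)
        · have hxM : x ∈ M := by
            by_contra hxM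
            have h1 := (hvM.eq_zero_iff hP hx).2 hxM
            have h2 := hile M x hxI hx
            omega
          -- Such a `j` lies in `K k`, since every `M'` with `v_{M'}(I) > k` contains `x ∈ I` and so
          -- its radical.
          obtain ⟨j, hj, hj0, hj1⟩ := hvM.exists_mem_rad_eq_one hP hx hxM
          refine ⟨q * j, ⟨q, hq, j, fun M' hM' hk' => ?_, rfl⟩, mul_notMem_zeroSet hq0 hj0, ?_⟩
          · refine mem_of_mem_rad hM'.isPrime ?_ hj
            by_contra hxM'
            have h1 := ((hv M' hM').eq_zero_iff hM'.isPrime hx).2 hxM'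
            have h2 := hile M' x hxI hx
            omega
          · rw [hvM.mul _ _ hq0 hj0]
            omega
        -- Semicontinuity applied to `i M`, whose value at `M` is below `k + 1`, gives an element of
        -- `K k` outside `M`: at each `M'` with `v_{M'}(I) > k` the value of `i M ∈ I` is at least
        -- `k + 1`.
        · obtain ⟨y, hyM, hy⟩ := exists_notMem_of_val_lt hv hR hM _ (i M) (hi0 M) rfl (k + 1)
            (by omega)
          have hy0 := hP.notMem_zeroSet hyM
          refine ⟨q * y, ⟨q, hq, y, fun M' hM' hk' => hy M' hM' ?_, rfl⟩,
            mul_notMem_zeroSet hq0 hy0, ?_⟩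
          · have := hile M' (i M) (hiI M) (hi0 M)
            omega
          · rw [hvM.mul _ _ hq0 hy0, (hvM.eq_zero_iff hP hy0).2 hyM]
            omega
  -- By minimality `v_M(I)` is at most the value of `x`, so `n` factors exhaust it at every `M`.
  have hbound : ∀ M, (tSystem H).IsMax M → v M (i M) ≤ n := fun M hM =>
    (hile M x hxI hx).trans (hn M hM)
  refine ⟨(List.range n).map K, ?_, ?_, ?_⟩
  · intro J hJ
    obtain ⟨k, -, rfl⟩ := List.mem_map.1 hJ
    exact ⟨hKideal k, hKrad k⟩
  · intro J hJ J' hJ'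
    obtain ⟨k, -, rfl⟩ := List.mem_map.1 hJ
    obtain ⟨l, -, rfl⟩ := List.mem_map.1 hJ'
    exact (le_total k l).imp (hKmono k l) (hKmono l k)
  · refine Set.Subset.antisymm (fun y hy => mem_wSystem_cl.2 fun M hM => ?_)
      (fun y hy => mem_of_local hI fun M hM => ?_)
    · have hP := hM.isPrime
      by_cases hy0 : y ∈ zeroSet H
      · exact ⟨1, hP.one_notMem, mem_sSystem_cl.2 (Or.inr (by rwa [one_mul]))⟩
      obtain ⟨-, q, hq, hq0, hqv⟩ := hprod M hM n
      have h1 := hile M y hy hy0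
      have h2 := hbound M hM
      obtain ⟨s, hs, h⟩ := ((hv M hM).le_iff q y hq0 hy0).1 (by omega)
      exact ⟨s, hs, mem_sSystem_cl.2 (Or.inl ⟨q, hq, h⟩)⟩
    · have hP := hM.isPrime
      by_cases hy0 : y ∈ zeroSet H
      · exact ⟨1, hP.one_notMem, by rw [one_mul]; exact hI.zeroSet_subset hy0⟩
      obtain ⟨s, hs, h⟩ := mem_wSystem_cl.1 hy M hM
      have hsy := mul_notMem_zeroSet (hP.notMem_zeroSet hs) hy0
      rcases mem_sSystem_cl.1 h with ⟨q, hq, hdvd⟩ | h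
      · have hq0 := notMem_zeroSet_of_dvd hdvd hsy
        have h1 := (hprod M hM n).1 q hq hq0
        have h2 := hbound M hM
        have h3 := ((hv M hM).le_iff q y hq0 hy0).2 ⟨s, hs, hdvd⟩
        obtain ⟨t, ht, h⟩ := ((hv M hM).le_iff (i M) y (hi0 M) hy0).1 (by omega)
        exact ⟨t, ht, hI.mem_of_dvd (hiI M) h⟩
      · exact absurd h hsy

end RadicalsOfPrincipalIdeals

/-! ### Complete integral closure and finite conductors. -/

section FiniteConductor

variable {H : Type*} [CommMonoid H] [IsNonzeroCancel H]

/-- Compare exponents: if `r` is locally radical and `c` is a product of `m` locally radical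
elements such that `r ^ (m + 1)` divides `c * y ^ N` locally, then `r` divides `y` locally. -/
theorem lDvd_of_pow_lDvd_mul {M : Set H} (hM : IsPrimeIdeal M) {r y : H} (hr : LRad M r) {N : ℕ}
    (hN : 0 < N) (cs : List H) (hcs : ∀ i ∈ cs, LRad M i ∧ i ∉ zeroSet H)
    (h : LDvd M (r ^ (cs.length + 1)) (cs.prod * y ^ N)) : LDvd M r y := by
  induction cs with
  | nil => exact hr y N hN (by simpa using h)
  | cons s cs ih =>
    refine ih (fun i hi => hcs i (List.mem_cons_of_mem _ hi)) ?_
    obtain ⟨hsr, hs0⟩ := hcs s List.mem_cons_self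
    obtain ⟨t, ht, z, hz⟩ := h
    rw [List.length_cons, List.prod_cons] at hz
    -- Each locally radical factor `s` of the multiplier absorbs at most one `r`: `s` divides a
    -- power of `r * z`, hence `r * z` itself locally, so `s` can be cancelled at the cost of one
    -- factor `r`.
    obtain ⟨t', ht', e, he⟩ := hsr (r * z) (cs.length + 1 + 1) (Nat.succ_pos _)
      (hM.lDvd_of_dvd ⟨t * cs.prod * y ^ N * z ^ (cs.length + 1), by
        calc (r * z) ^ (cs.length + 1 + 1)
            = r ^ (cs.length + 1 + 1) * z * z ^ (cs.length + 1) := by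
              rw [mul_pow, pow_succ z]; ac_rfl
          _ = _ := by rw [← hz]; ac_rfl⟩)
    refine ⟨t' * t, hM.mul_notMem ht' ht, e, eq_of_mul_eq_mul hs0 ?_⟩
    calc s * (t' * t * (cs.prod * y ^ N)) = t' * (t * (s * cs.prod * y ^ N)) := by ac_rfl
      _ = r ^ (cs.length + 1) * (t' * (r * z)) := by rw [hz, pow_succ r (cs.length + 1)]; ac_rfl
      _ = s * (r ^ (cs.length + 1) * e) := by rw [he]; ac_rfl

/-- The radical factors are split off `y` one at a time; after cancelling `r ^ n` the same
hypothesis holds for the quotient. -/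
theorem list_prod_lDvd_of_pow_lDvd {M : Set H} (hM : IsPrimeIdeal M) (cs : List H)
    (hcs : ∀ i ∈ cs, LRad M i ∧ i ∉ zeroSet H) (rs : List H)
    (hrs : ∀ i ∈ rs, LRad M i ∧ i ∉ zeroSet H) (y : H)
    (h : ∀ n : ℕ, LDvd M (rs.prod ^ n) (cs.prod * y ^ n)) : LDvd M rs.prod y := by
  induction rs generalizing y with
  | nil => exact hM.lDvd_of_dvd (by simp)
  | cons r rs ih =>
    simp only [List.prod_cons] at h ⊢
    obtain ⟨hr, hr0⟩ := hrs r List.mem_cons_self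
    obtain ⟨s, hs, y', hy'⟩ := lDvd_of_pow_lDvd_mul hM hr (Nat.succ_pos cs.length) cs hcs
      (hM.lDvd_trans (hM.lDvd_of_dvd (pow_dvd_pow_of_dvd (dvd_mul_right r rs.prod) _))
        (h (cs.length + 1)))
    have h1 : LDvd M rs.prod y' := by
      refine ih (fun i hi => hrs i (List.mem_cons_of_mem _ hi)) y' fun n => ?_
      obtain ⟨t, ht, h⟩ := h n
      refine ⟨t, ht, dvd_of_mul_dvd_mul (pow_notMem_zeroSet hr0 n) ?_⟩
      rw [← mul_pow]
      refine h.trans ⟨s ^ n, ?_⟩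
      calc r ^ n * (t * (cs.prod * y' ^ n)) = t * (cs.prod * (r * y') ^ n) := by
            rw [mul_pow]; ac_rfl
        _ = t * (cs.prod * y ^ n) * s ^ n := by rw [← hy', mul_pow]; ac_rfl
    refine hM.lDvd_of_lDvd_mul hs ?_
    rw [hy']
    exact hM.lDvd_mul (hM.lDvd_refl r) h1

/-- A monoid whose principal ideals factor into radical ideals is completely integrally closed. -/
theorem dvd_of_forall_pow_dvd
    (hF : ∀ x : H, x ∉ zeroSet H → HasRadicalFactorization ((sSystem H).cl {x})) {c x y : H}
    (hc : c ∉ zeroSet H) (hx : x ∉ zeroSet H) (h : ∀ n : ℕ, x ^ n ∣ c * y ^ n) : x ∣ y := by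
  refine dvd_of_local fun M hM => ?_
  have hP := hM.isPrime
  obtain ⟨rs, hrs, hr1, hr2⟩ := exists_lRad_factorization hx (hF x hx) hM
  obtain ⟨cs, hcs, hc1, hc2⟩ := exists_lRad_factorization hc (hF c hc) hM
  refine hP.lDvd_trans hr2 (list_prod_lDvd_of_pow_lDvd hP cs hcs rs hrs y fun n => ?_)
  exact hP.lDvd_trans (hP.lDvd_pow hr1 n) (hP.lDvd_trans (hP.lDvd_of_dvd (h n))
    (hP.lDvd_mul hc2 (hP.lDvd_refl _)))

theorem isFG_univ : (wSystem H).IsFG Set.univ := by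
  have h := (wSystem H).cl_eq_univ (X := {1}) ((wSystem H).subset_cl _ rfl)
  exact ⟨h ▸ (wSystem H).isIdeal_cl _, {1}, Set.subset_univ _, Set.finite_singleton 1, h.symm⟩

/-- Locally, an element of `A ∩ B` is a common multiple of one generator of `A` and one of `B`, so
generators of the ideals `eH ∩ e'H` together suffice. -/
theorem isFG_inter (hC : (wSystem H).IsFiniteConductor) {A B : Set H} (hA : (wSystem H).IsFG A)
    (hB : (wSystem H).IsFG B) : (wSystem H).IsFG (A ∩ B) := by
  obtain ⟨hA, E, hEA, hE, hAE⟩ := hA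
  obtain ⟨hB, E', hEB, hE', hBE⟩ := hB
  have hsub : ∀ e ∈ E, ∀ e' ∈ E', (sSystem H).cl {e} ∩ (sSystem H).cl {e'} ⊆ A ∩ B := by
    rintro e he e' he' y ⟨hy, hy'⟩
    exact ⟨hA.mem_of_dvd (hEA he) (mem_sSystem_cl_singleton.1 hy),
      hB.mem_of_dvd (hEB he') (mem_sSystem_cl_singleton.1 hy')⟩
  choose F hF hfin hFeq using fun x y => (hC x y).2
  have hFsub : (⋃ e ∈ E, ⋃ e' ∈ E', F e e') ⊆ A ∩ B :=
    Set.iUnion₂_subset fun e he => Set.iUnion₂_subset fun e' he' =>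
      (hF e e').trans (hsub e he e' he')
  have hI := isIdeal_inter (wSystem H) hA hB
  refine ⟨hI, ⋃ e ∈ E, ⋃ e' ∈ E', F e e', hFsub,
    hE.biUnion fun e _ => hE'.biUnion fun e' _ => hfin e e', ?_⟩
  refine Set.Subset.antisymm (fun y hy => ?_) (hI.cl_subset hFsub)
  refine mem_of_local ((wSystem H).isIdeal_cl _) fun M hM => ?_
  have hP := hM.isPrime
  obtain ⟨s, hs, h⟩ := mem_wSystem_cl.1 (hAE.subset hy.1) M hM
  obtain ⟨t, ht, h'⟩ := mem_wSystem_cl.1 (hBE.subset hy.2) M hM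
  refine ⟨s * t, hP.mul_notMem hs ht, ?_⟩
  have hz := ((wSystem H).isIdeal_cl (⋃ e ∈ E, ⋃ e' ∈ E', F e e')).zeroSet_subset
  rcases mem_sSystem_cl.1 h with ⟨e, he, h⟩ | h
  · rcases mem_sSystem_cl.1 h' with ⟨e', he', h'⟩ | h'
    · have h1 : s * t * y ∈ (wSystem H).cl (F e e') := by
        rw [← hFeq]
        constructor <;> rw [mem_sSystem_cl_singleton]
        · rw [mul_right_comm]; exact h.mul_right t
        · rw [mul_assoc]; exact h'.mul_left s
      refine (wSystem H).cl_mono ?_ h1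
      exact (Set.subset_biUnion_of_mem (u := fun e' => F e e') he').trans
        (Set.subset_biUnion_of_mem (u := fun e => ⋃ e' ∈ E', F e e') he)
    · refine hz ?_
      rw [mul_assoc, mul_comm]; exact zero_mul_mem h' s
  · refine hz ?_
    rw [mul_right_comm]; exact zero_mul_mem h t

/-- Multiplication by a nonzero `f` identifies this ideal with `cH ∩ fH`. -/
theorem isFG_colon (hC : (wSystem H).IsFiniteConductor) (c f : H) :
    (wSystem H).IsFG {y | c ∣ f * y} := by
  by_cases hf : f ∈ zeroSet H
  · have : {y | c ∣ f * y} = Set.univ := Set.eq_univ_of_forall fun y =>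
      dvd_of_mem_zeroSet (zero_mul_mem hf y) c
    rw [this]
    exact isFG_univ
  obtain ⟨-, F, hF, hfin, hEq⟩ := hC c f
  have hFim : (fun y => f * y) '' ((fun y => f * y) ⁻¹' F) = F := by
    refine Set.image_preimage_eq_of_subset fun y hy => ?_
    obtain ⟨e, rfl⟩ := mem_sSystem_cl_singleton.1 (hF hy).2
    exact ⟨e, rfl⟩
  have hEq' : {y | c ∣ f * y} = (wSystem H).cl ((fun y => f * y) ⁻¹' F) := by
    ext y
    have h1 := (wSystem H).mul_cl f ((fun y => f * y) ⁻¹' F)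
    rw [hFim, ← hEq] at h1
    have h2 : c ∣ f * y ↔ f * y ∈ (sSystem H).cl {c} ∩ (sSystem H).cl {f} := by
      rw [Set.mem_inter_iff, mem_sSystem_cl_singleton, mem_sSystem_cl_singleton]
      exact ⟨fun h => ⟨h, dvd_mul_right _ _⟩, fun h => h.1⟩
    rw [Set.mem_ofPred_eq, h2, ← h1]
    constructor
    · rintro ⟨y', hy', h⟩
      rwa [← eq_of_mul_eq_mul hf h]
    · exact fun h => ⟨y, h, rfl⟩
  refine ⟨hEq' ▸ (wSystem H).isIdeal_cl _, (fun y => f * y) ⁻¹' F, ?_,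
    hfin.preimage fun a _ b _ h => eq_of_mul_eq_mul hf h, hEq'⟩
  exact hEq' ▸ (wSystem H).subset_cl _

theorem isFG_colon_finite (hC : (wSystem H).IsFiniteConductor) (c : H) {F : Set H}
    (hF : F.Finite) : (wSystem H).IsFG {y | ∀ f ∈ F, c ∣ f * y} := by
  induction F, hF using Set.Finite.induction_on with
  | empty => simpa using isFG_univ
  | @insert a F _ _ ih =>
    have : {y | ∀ f ∈ insert a F, c ∣ f * y} = {y | c ∣ a * y} ∩ {y | ∀ f ∈ F, c ∣ f * y} := by
      ext y; simp
    rw [this]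
    exact isFG_inter hC (isFG_colon hC c a) ih

/-- In a completely integrally closed `w`-finite conductor monoid the intersection of two principal
ideals is locally invertible. -/
theorem exists_invAt_inter_of_isFiniteConductor (hG : ¬ EqQuot H)
    (hC : (wSystem H).IsFiniteConductor)
    (hcic : ∀ c x y : H, c ∉ zeroSet H → x ∉ zeroSet H → (∀ n : ℕ, x ^ n ∣ c * y ^ n) → x ∣ y)
    {a b : H} (ha : a ∉ zeroSet H) (hb : b ∉ zeroSet H) {M : Set H} (hM : (tSystem H).IsMax M) :
    ∃ f ∈ {y | a ∣ y ∧ b ∣ y}, InvAt M {y | a ∣ y ∧ b ∣ y} f := by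
  obtain ⟨-, F, hF, hFfin, hFeq⟩ := hC a b
  have hI : ∀ y, a ∣ y ∧ b ∣ y ↔ y ∈ (wSystem H).cl F := by
    intro y
    rw [← hFeq, Set.mem_inter_iff, mem_sSystem_cl_singleton, mem_sSystem_cl_singleton]
  have hFI : ∀ f ∈ F, a ∣ f ∧ b ∣ f := fun f hf => (hI f).2 ((wSystem H).subset_cl _ hf)
  obtain ⟨c, hc⟩ : ∃ c, c = a * b := ⟨_, rfl⟩
  have hc0 : c ∉ zeroSet H := hc ▸ mul_notMem_zeroSet ha hb
  have hcF : c ∈ (wSystem H).cl F := (hI c).1 (hc ▸ ⟨dvd_mul_right _ _, dvd_mul_left _ _⟩)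
  obtain ⟨-, E, hE, hEfin, hEeq⟩ := isFG_colon_finite hC c hFfin
  -- With `I = aH ∩ bH = F_w` and `c = a * b ∈ I`, this is `c * I⁻¹`, with finite generating set
  -- `E`. The finite set `Q` below consists of the products `f * (e / c)` of generators of `I` and
  -- `I⁻¹`.
  set Y : Set H := {y | ∀ f ∈ F, c ∣ f * y}
  set Q : Set H := {q | ∃ f ∈ F, ∃ e ∈ E, e * f = c * q}
  have hQfin : Q.Finite := by
    have h1 : ((fun q => c * q) ⁻¹' (E * F)).Finite :=
      (hEfin.mul hFfin).preimage fun a _ b _ h => eq_of_mul_eq_mul hc0 h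
    refine h1.subset ?_
    rintro q ⟨f, hf, e, he, h⟩
    exact ⟨e, he, f, hf, h⟩
  -- A fraction `c1 / d1` mapping `Q` into `H` maps `Y` into itself. Starting with `c ∈ Y`, all `c *
  -- (c1 / d1) ^ n` lie in `H`, so `c1 / d1 ∈ H` by complete integral closure.
  have h1 : (1 : H) ∈ vCl Q := by
    rw [mem_vCl_iff hG]
    intro c1 d1 hd1 hdvd
    rw [mul_one]
    have hstep : ∀ y ∈ Y, ∃ y' ∈ Y, c1 * y = d1 * y' := by
      intro y hy
      have h2 : ∀ f ∈ F, c * d1 ∣ c1 * f * y := by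
        intro f hf
        refine dvd_of_mem_wSystem_cl (X := E) (fun e he => ?_) (hEeq ▸ hy)
        obtain ⟨q, hq⟩ := hE he f hf
        have := hdvd q ⟨f, hf, e, he, by rw [mul_comm, hq]⟩
        rw [mul_assoc, hq, mul_left_comm]
        exact mul_dvd_mul_left c this
      have h3 : c * d1 ∣ c1 * y * c := by
        refine dvd_of_mem_wSystem_cl (X := F) (fun f hf => ?_) hcF
        rw [mul_right_comm]
        exact h2 f hf
      rw [mul_comm _ c] at h3
      obtain ⟨y', hy'⟩ := dvd_of_mul_dvd_mul hc0 h3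
      refine ⟨y', fun f hf => ?_, hy'⟩
      have h4 := h2 f hf
      rw [mul_right_comm, hy', mul_comm c, mul_assoc d1] at h4
      rw [mul_comm f]
      exact dvd_of_mul_dvd_mul hd1 h4
    have hpow : ∀ n : ℕ, ∃ y ∈ Y, c * c1 ^ n = d1 ^ n * y := by
      intro n
      induction n with
      | zero => exact ⟨c, fun f _ => dvd_mul_left _ _, by simp⟩
      | succ n ih =>
        obtain ⟨y, hy, h⟩ := ih
        obtain ⟨y', hy', h'⟩ := hstep y hy
        refine ⟨y', hy', ?_⟩
        rw [pow_succ, ← mul_assoc, h, pow_succ, mul_assoc, mul_comm y, h', mul_assoc]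
    exact hcic c d1 c1 hc0 hd1 fun n => by
      obtain ⟨y, -, h⟩ := hpow n
      exact ⟨y, h⟩
  obtain ⟨q, ⟨f, hf, e, he, hef⟩, hq⟩ := (tSystem H).cl_eq_univ_iff.1
    ((tSystem H).cl_eq_univ (vCl_subset_tSystem_cl subset_rfl hQfin h1)) M hM
  refine ⟨f, hFI f hf, e, c, q, hc0, hq, hef, fun y hy => ?_⟩
  refine dvd_of_mem_wSystem_cl (X := F) (fun f hf => ?_) ((hI y).1 hy)
  rw [mul_comm]
  exact hE he f hf

/-- Locally at a `t`-maximal ideal, elements are comparable if intersections of two principal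
ideals are locally invertible. -/
theorem lDvd_total_of_invAt_inter (hG : ¬ EqQuot H) {M : Set H} (hM : (tSystem H).IsMax M)
    (hinv : ∀ a b : H, a ∉ zeroSet H → b ∉ zeroSet H →
      ∃ f ∈ {y | a ∣ y ∧ b ∣ y}, InvAt M {y | a ∣ y ∧ b ∣ y} f)
    {a b : H} (ha : a ∉ zeroSet H) (hb : b ∉ zeroSet H) : LDvd M a b ∨ LDvd M b a := by
  have hP := hM.isPrime
  obtain ⟨f, ⟨⟨α, hα⟩, β, hβ⟩, hf⟩ := hinv a b ha hb
  obtain ⟨s, hs, d, hd⟩ := hf.lDvd (y := a * b) ⟨dvd_mul_right _ _, dvd_mul_left _ _⟩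
  have hsab : s * (a * b) ∉ zeroSet H :=
    mul_notMem_zeroSet (hP.notMem_zeroSet hs) (mul_notMem_zeroSet ha hb)
  have hf0 : f ∉ zeroSet H := notMem_zeroSet_of_dvd ⟨d, hd⟩ hsab
  have hd0 : d ∉ zeroSet H := notMem_zeroSet_of_dvd ⟨f, by rw [hd, mul_comm]⟩ hsab
  have hα0 : α ∉ zeroSet H := notMem_zeroSet_of_dvd ⟨a, by rw [hα, mul_comm]⟩ hf0
  have hβ0 : β ∉ zeroSet H := notMem_zeroSet_of_dvd ⟨b, by rw [hβ, mul_comm]⟩ hf0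
  by_cases hαM : α ∈ M
  swap
  · exact Or.inr ⟨α, hαM, β, by rw [mul_comm, ← hα, hβ]⟩
  by_cases hβM : β ∈ M
  swap
  · exact Or.inl ⟨β, hβM, α, by rw [mul_comm, ← hβ, hα]⟩
  exfalso
  -- Here `d` acts as a local gcd of `a` and `b`, with cofactors `β` and `α`. Locally, common
  -- multiples of `α` and `β` are multiples of `α * β`, so by `not_invAt_of_lDvd_mul` they cannot
  -- both be in `M`.
  have hαd : s * b = α * d := eq_of_mul_eq_mul ha (by
    rw [← mul_assoc a α, ← hα, ← hd]; ac_rfl)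
  have hβd : s * a = β * d := eq_of_mul_eq_mul hb (by
    rw [← mul_assoc b β, ← hβ, ← hd]; ac_rfl)
  obtain ⟨g, hg, hginv⟩ := hinv α β hα0 hβ0
  refine not_invAt_of_lDvd_mul (C := {y | α ∣ y ∧ β ∣ y}) hG hM hαM hβM hα0 hβ0 (fun y h1 h2 => ⟨h1, h2⟩)
    (fun y hy => ?_) hg hginv
  obtain ⟨⟨y1, hy1⟩, y2, hy2⟩ := hy
  obtain ⟨t, ht, h, hh⟩ := hf.lDvd (y := d * y) ⟨⟨s * y2, by
      rw [hy2, ← mul_assoc, ← mul_assoc, mul_comm d, ← hβd, mul_comm a]⟩, s * y1, by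
      rw [hy1, ← mul_assoc, ← mul_assoc, mul_comm d, ← hαd, mul_comm b]⟩
  refine ⟨s * t, hP.mul_notMem hs ht, h, eq_of_mul_eq_mul hd0 ?_⟩
  calc d * (s * t * y) = s * (t * (d * y)) := by ac_rfl
    _ = (s * a) * α * h := by rw [hh, hα]; ac_rfl
    _ = d * (α * β * h) := by rw [hβd]; ac_rfl

end FiniteConductor

/-! ### Translation to the localizations `H_M`. -/

section Localization

variable {H : Type*} [CommMonoid H]

theorem mk_dvd_mk_iff {M : Set H} (hM : IsPrimeIdeal M) {x y : H} {s t : hM.compl} :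
    Localization.mk x s ∣ Localization.mk y t ↔ LDvd M x y := by
  constructor
  · rintro ⟨g, hg⟩
    induction g using Localization.induction_on with | _ g
    obtain ⟨a, u⟩ := g
    rw [Localization.mk_mul, Localization.mk_eq_mk_iff, Localization.r_iff_exists] at hg
    obtain ⟨c, hc⟩ := hg
    refine ⟨c * (s * u : hM.compl), hM.mul_notMem c.2 (s * u).2, c * t * a, ?_⟩
    rw [mul_assoc]
    exact hc.trans (by simp only; ac_rfl)
  · rintro ⟨s', hs', e, he⟩
    refine ⟨Localization.mk (e * s) (t * ⟨s', hs'⟩), ?_⟩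
    rw [Localization.mk_mul, Localization.mk_eq_mk_iff, Localization.r_iff_exists]
    refine ⟨1, ?_⟩
    simp only [Submonoid.coe_mul, Submonoid.coe_one, one_mul]
    calc (s : H) * (t * s') * y = s * t * (s' * y) := by ac_rfl
      _ = t * (x * (e * s)) := by rw [he]; ac_rfl

variable [IsNonzeroCancel H]

omit [IsNonzeroCancel H] in
theorem mk_mem_zeroSet {M : Set H} (hM : IsPrimeIdeal M) {x : H} (hx : x ∈ zeroSet H)
    (s : hM.compl) : Localization.mk x s ∈ zeroSet (LocAt hM) := by
  intro k
  induction k using Localization.induction_on with | _ k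
  obtain ⟨d, w⟩ := k
  rw [Localization.mk_mul, Localization.mk_eq_mk_iff, Localization.r_iff_exists]
  refine ⟨1, ?_⟩
  simp only [Submonoid.coe_mul, hx d, mul_comm _ x, hx _]

/-- The ideal generated by two elements is principal; in a monoid its generator is itself a multiple
of one of the two. -/
theorem lDvd_total_of_isDVM {M : Set H} (hM : IsPrimeIdeal M) (h : IsDVM (LocAt hM)) (x y : H) :
    LDvd M x y ∨ LDvd M y x := by
  rw [← mk_dvd_mk_iff hM (s := 1) (t := 1), ← mk_dvd_mk_iff hM (s := 1) (t := 1)]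
  generalize (Localization.mk x 1 : LocAt hM) = a
  generalize (Localization.mk y 1 : LocAt hM) = b
  obtain ⟨A, hA, hX⟩ := h.2 _ ((sSystem (LocAt hM)).isIdeal_cl {a, b})
  have ha := hX.subset ((sSystem _).subset_cl {a, b} (by simp : a ∈ ({a, b} : Set (LocAt hM))))
  have hb := hX.subset ((sSystem _).subset_cl {a, b} (by simp : b ∈ ({a, b} : Set (LocAt hM))))
  rcases hA.eq_empty_or_singleton with rfl | ⟨g, rfl⟩
  · rcases mem_sSystem_cl.1 hb with ⟨_, h, -⟩ | h
    · exact absurd h (Set.notMem_empty _)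
    · exact Or.inl (dvd_of_mem_zeroSet h a)
  · rw [mem_sSystem_cl_singleton] at ha hb
    rcases mem_sSystem_cl.1 (hX.superset (mem_sSystem_cl_singleton.2 dvd_rfl)) with
      ⟨_, rfl | rfl, h⟩ | h
    · exact Or.inl (h.trans hb)
    · exact Or.inr (h.trans ha)
    · exact Or.inl ((dvd_of_mem_zeroSet h a).trans hb)

/-- An ideal with nonzero elements is generated by a fraction whose numerator has minimal value; an
element of value 1 is a nonzero nonunit, so `H_M` is not its own quotient monoid. -/
theorem IsLocVal.isDVM {M : Set H} {v : H → ℕ} (hv : IsLocVal M v) (hM : IsPrimeIdeal M) :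
    IsDVM (LocAt hM) := by
  constructor
  · intro hG
    obtain ⟨p, hp0, hp⟩ := hv.exists_eq_one
    have hpM : p ∈ M := by
      by_contra hpM
      have := (hv.eq_zero_iff hM hp0).2 hpM
      omega
    have hz : (Localization.mk p 1 : LocAt hM) ∉ zeroSet (LocAt hM) := by
      intro h
      have h1 := h (Localization.mk p 1)
      rw [Localization.mk_mul, Localization.mk_eq_mk_iff, Localization.r_iff_exists] at h1
      obtain ⟨c, hc⟩ := h1
      simp only [Submonoid.coe_one, one_mul] at hc
      have hp1 : p = 1 := by
        refine eq_of_mul_eq_mul hp0 (eq_of_mul_eq_mul (hM.zero_notMem_compl c.2) ?_)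
        rw [mul_one, hc]
      rw [hp1, hv.one] at hp
      omega
    have h1 := (isUnit_of_eqQuot hG hz).dvd (a := 1)
    rw [← Localization.mk_one, mk_dvd_mk_iff hM] at h1
    exact hM.one_notMem (hM.mem_of_lDvd hpM h1)
  · intro X hX
    by_cases hXz : X ⊆ zeroSet (LocAt hM)
    · refine ⟨∅, Set.subsingleton_empty, Set.Subset.antisymm
        (fun g hg => mem_sSystem_cl.2 (Or.inr (hXz hg))) (hX.cl_subset (Set.empty_subset _))⟩
    · have hne : (v '' {x | x ∉ zeroSet H ∧ ∃ s, (Localization.mk x s : LocAt hM) ∈ X}).Nonempty := by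
        obtain ⟨g, hg, hg0⟩ := Set.not_subset.1 hXz
        induction g using Localization.induction_on with | _ g
        exact ⟨_, g.1, ⟨fun h => hg0 (mk_mem_zeroSet hM h g.2), g.2, hg⟩, rfl⟩
      obtain ⟨x, ⟨hx0, s, hxs⟩, hxv⟩ := Nat.sInf_mem hne
      refine ⟨{Localization.mk x s}, Set.subsingleton_singleton, Set.Subset.antisymm
        (fun g hg => mem_sSystem_cl_singleton.2 ?_)
        (hX.cl_subset (Set.singleton_subset_iff.2 hxs))⟩
      induction g using Localization.induction_on with | _ g
      obtain ⟨y, t⟩ := g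
      by_cases hy : y ∈ zeroSet H
      · exact dvd_of_mem_zeroSet (mk_mem_zeroSet hM hy t) _
      · rw [mk_dvd_mk_iff hM, ← hv.le_iff x y hx0 hy, hxv]
        exact Nat.sInf_le ⟨y, ⟨hy, t, hg⟩, rfl⟩

end Localization

/-! ### The degenerate case `H = G`. -/

section QuotientMonoid

variable {H : Type*} [CommMonoid H] [IsNonzeroCancel H]

theorem FinIdealSystem.IsIdeal.eq_zeroSet_or_univ {r : FinIdealSystem H} (hG : EqQuot H)
    {I : Set H} (hI : r.IsIdeal I) : I = zeroSet H ∨ I = Set.univ := by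
  by_cases h : I ⊆ zeroSet H
  · exact Or.inl (Set.Subset.antisymm h hI.zeroSet_subset)
  · obtain ⟨x, hx, hx0⟩ := Set.not_subset.1 h
    exact Or.inr (Set.eq_univ_of_forall fun y =>
      hI.mem_of_dvd hx (isUnit_of_eqQuot hG hx0).dvd)

omit [IsNonzeroCancel H] in
theorem isRadical_univ : IsRadical (Set.univ : Set H) :=
  Set.Subset.antisymm (Set.subset_univ _) fun _ _ => ⟨1, one_pos, trivial⟩

theorem exists_singleton_factorization {r : FinIdealSystem H} (hG : EqQuot H) {I : Set H}
    (hI : r.IsIdeal I) : (∀ J ∈ [I], r.IsIdeal J ∧ IsRadical J) ∧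
      (∀ J ∈ [I], ∀ K ∈ [I], J ⊆ K ∨ K ⊆ J) ∧ r.IsProd I [I] := by
  refine ⟨fun J hJ => ?_, fun J hJ K hK => ?_, ?_⟩
  · rw [List.mem_singleton.1 hJ]
    rcases hI.eq_zeroSet_or_univ hG with h | h
    · exact ⟨hI, h ▸ isRadical_zeroSet⟩
    · exact ⟨hI, h ▸ isRadical_univ⟩
  · rw [List.mem_singleton.1 hJ, List.mem_singleton.1 hK]
    exact Or.inl subset_rfl
  · rw [FinIdealSystem.IsProd, List.prod_singleton]
    exact hI.symm

theorem lDvd_total_of_eqQuot (hG : EqQuot H) {M : Set H} (hM : IsPrimeIdeal M) (x y : H) :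
    LDvd M x y ∨ LDvd M y x := by
  by_cases hx : x ∈ zeroSet H
  · exact Or.inr (hM.lDvd_of_dvd (dvd_of_mem_zeroSet hx y))
  · exact Or.inl (hM.lDvd_of_dvd (isUnit_of_eqQuot hG hx).dvd)

theorem exists_invAt_rad_of_eqQuot (hG : EqQuot H) (x : H) (hx : x ∉ zeroSet H) (M : Set H)
    (hM : (tSystem H).IsMax M) :
    ∃ a ∈ rad ((sSystem H).cl {x}), InvAt M (rad ((sSystem H).cl {x})) a :=
  ⟨1, ⟨1, one_pos, mem_sSystem_cl_singleton.2 (isUnit_of_eqQuot hG hx).dvd⟩, 1, 1, 1,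
    one_notMem_zeroSet, hM.isPrime.one_notMem, rfl, fun _ _ => one_dvd _⟩

end QuotientMonoid

/-! ### Assembling the equivalences. -/

section Main

variable {H : Type*} [CommMonoid H] [IsNonzeroCancel H]

theorem IsPrincipalIdeal.isIdeal_wSystem {I : Set H} (hI : IsPrincipalIdeal I) :
    (wSystem H).IsIdeal I := by
  obtain ⟨A, hA, rfl⟩ := hI
  rcases hA.eq_empty_or_singleton with rfl | ⟨x, rfl⟩
  · have : (sSystem H).cl ∅ = zeroSet H := by
      ext x; simp [mem_sSystem_cl]
    rw [this]
    exact isFG_zeroSet.1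
  · exact (wSystem H).isIdeal_singleton x

omit [IsNonzeroCancel H] in
theorem isPrincipalIdeal_singleton (x : H) : IsPrincipalIdeal ((sSystem H).cl {x}) :=
  ⟨{x}, Set.subsingleton_singleton, rfl⟩

theorem tSystem_eq_wSystem (hG : ¬ EqQuot H)
    (h : ∀ M, (tSystem H).IsMax M → ∀ x y, LDvd M x y ∨ LDvd M y x) : tSystem H = wSystem H := by
  have key : ∀ r r' : FinIdealSystem H, r.cl = r'.cl → r = r' := by
    rintro ⟨⟩ ⟨⟩ h
    congr
  exact key _ _ (funext (tSystem_cl_eq_wSystem_cl hG h))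

theorem exists_isLocVal_of_isSP (hG : ¬ EqQuot H) (h : (wSystem H).IsSP) (M : Set H)
    (hM : (tSystem H).IsMax M) : ∃ v, IsLocVal M v :=
  exists_isLocVal_of_comparable hG hM (fun x _ => h _ ((wSystem H).isIdeal_singleton x))
    fun _ _ _ hb ha0 hb0 hr => lDvd_or_of_hasRadicalFactorization h hM hb ha0 hb0 hr

theorem exists_isLocVal_of_isFiniteConductor (hG : ¬ EqQuot H)
    (hC : (wSystem H).IsFiniteConductor)
    (hF : ∀ x : H, x ∉ zeroSet H → HasRadicalFactorization ((sSystem H).cl {x})) (M : Set H)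
    (hM : (tSystem H).IsMax M) : ∃ v, IsLocVal M v :=
  exists_isLocVal_of_comparable hG hM hF fun _ _ _ _ ha0 hb0 _ =>
    lDvd_total_of_invAt_inter hG hM (fun _ _ ha hb => exists_invAt_inter_of_isFiniteConductor hG hC
      (fun _ _ _ hc hx h => dvd_of_forall_pow_dvd hF hc hx h) ha hb hM) ha0 hb0

theorem isSP_of_radPrincipalInvertible (hG : ¬ EqQuot H)
    (hR : (wSystem H).RadPrincipalInvertible) (I : Set H) (hI : (wSystem H).IsIdeal I) :
    ∃ L : List (Set H), (∀ J ∈ L, (wSystem H).IsIdeal J ∧ IsRadical J) ∧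
      (∀ J ∈ L, ∀ K ∈ L, J ⊆ K ∨ K ⊆ J) ∧ (wSystem H).IsProd I L := by
  have hR' := forall_of_radPrincipal _ (fun _ => wSystem_isInvertible_iff) hR
  have hv := exists_isLocVal_of_invAt_rad hG hR'
  choose! v hv using hv
  exact exists_comparable_factorization hv hR' hI

theorem radPrincipalInvertible_wSystem_iff :
    (wSystem H).RadPrincipalInvertible ↔ (tSystem H).RadPrincipalInvertible :=
  ⟨fun h => radPrincipal_of_forall (forall_of_radPrincipal _ (fun _ => wSystem_isInvertible_iff) h)
      _ fun _ => tSystem_isInvertible_iff,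
    fun h => radPrincipal_of_forall (forall_of_radPrincipal _ (fun _ => tSystem_isInvertible_iff) h)
      _ fun _ => wSystem_isInvertible_iff⟩

end Main

end IdealSys

open IdealSys

theorem corollary4p4 {H : Type*} [CommMonoid H] [IdealSys.IsNonzeroCancel H] :
    [ -- `H` is a `t`-almost Dedekind `t`-SP-monoid
      (IdealSys.tSystem H).IsAlmostDedekind ∧ (IdealSys.tSystem H).IsSP,
      -- `H` is a `w`-SP-monoid
      (IdealSys.wSystem H).IsSP,
      -- `H` is a `w`-finite conductor monoid and every principal ideal is a finite `w`-product
      -- of radical `w`-ideals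
      (IdealSys.wSystem H).IsFiniteConductor ∧
        ∀ I : Set H, IdealSys.IsPrincipalIdeal I →
          ∃ L : List (Set H),
            (∀ J ∈ L, (IdealSys.wSystem H).IsIdeal J ∧ IdealSys.IsRadical J) ∧
              (IdealSys.wSystem H).IsProd I L,
      -- every `w`-ideal is a `w`-product of finitely many pairwise comparable radical `w`-ideals
      ∀ I : Set H, (IdealSys.wSystem H).IsIdeal I →
        ∃ L : List (Set H),
          (∀ J ∈ L, (IdealSys.wSystem H).IsIdeal J ∧ IdealSys.IsRadical J) ∧
            (∀ J ∈ L, ∀ K ∈ L, J ⊆ K ∨ K ⊆ J) ∧ (IdealSys.wSystem H).IsProd I L,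
      -- the radical of every nontrivial principal ideal is `w`-invertible
      (IdealSys.wSystem H).RadPrincipalInvertible ].TFAE ∧
    -- `H` is a `w`-SP-monoid iff the radical of every nontrivial principal ideal is `t`-invertible
    ((IdealSys.wSystem H).IsSP ↔ (IdealSys.tSystem H).RadPrincipalInvertible) := by
  by_cases hG : EqQuot H
  · have hR := exists_invAt_rad_of_eqQuot hG
    have hRw := radPrincipal_of_forall hR (wSystem H) fun _ => wSystem_isInvertible_iff
    have hRt := radPrincipal_of_forall hR (tSystem H) fun _ => tSystem_isInvertible_iff
    have hSP : ∀ r : FinIdealSystem H, r.IsSP := fun r I hI =>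
      ⟨[I], (exists_singleton_factorization hG hI).1, (exists_singleton_factorization hG hI).2.2⟩
    have hC := isFiniteConductor_of_lDvd_total fun M (hM : (tSystem H).IsMax M) =>
      lDvd_total_of_eqQuot hG hM.isPrime
    refine ⟨?_, fun _ => hRt, fun _ => hSP _⟩
    tfae_have 1 ↔ 2 := ⟨fun _ => hSP _, fun _ => ⟨Or.inl hG, hSP _⟩⟩
    tfae_have 3 ↔ 2 := ⟨fun _ => hSP _, fun _ => ⟨hC, fun I hI => hSP _ I hI.isIdeal_wSystem⟩⟩
    tfae_have 4 ↔ 2 := ⟨fun _ => hSP _, fun _ I hI => ⟨[I], exists_singleton_factorization hG hI⟩⟩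
    tfae_have 5 ↔ 2 := ⟨fun _ => hSP _, fun _ => hRw⟩
    tfae_finish
  · have h25 : (wSystem H).IsSP → (wSystem H).RadPrincipalInvertible := fun h =>
      radPrincipal_of_forall (exists_invAt_rad
        (fun x _ => h _ ((wSystem H).isIdeal_singleton x)) (exists_isLocVal_of_isSP hG h)) _
        fun _ => wSystem_isInvertible_iff
    have h42 : (∀ I : Set H, (wSystem H).IsIdeal I → ∃ L : List (Set H),
        (∀ J ∈ L, (wSystem H).IsIdeal J ∧ IdealSys.IsRadical J) ∧
          (∀ J ∈ L, ∀ K ∈ L, J ⊆ K ∨ K ⊆ J) ∧ (wSystem H).IsProd I L) → (wSystem H).IsSP :=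
      fun h I hI => (h I hI).imp fun _ hL => ⟨hL.1, hL.2.2⟩
    refine ⟨?_, fun h => radPrincipalInvertible_wSystem_iff.1 (h25 h), fun h =>
      h42 (isSP_of_radPrincipalInvertible hG (radPrincipalInvertible_wSystem_iff.2 h))⟩
    -- Almost Dedekind gives local comparability, hence `t = w`, and the SP property transfers
    -- verbatim.
    tfae_have 1 → 2 := by
      rintro ⟨h, hSP⟩
      rwa [tSystem_eq_wSystem hG fun M hM =>
        lDvd_total_of_isDVM hM.isPrime (h.resolve_left hG M hM)] at hSP
    tfae_have 2 → 1 := by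
      intro h
      have hv := exists_isLocVal_of_isSP hG h
      refine ⟨Or.inr fun M hM => (hv M hM).choose_spec.isDVM hM.isPrime, ?_⟩
      rwa [tSystem_eq_wSystem hG fun M hM => (hv M hM).choose_spec.lDvd_total hM.isPrime]
    tfae_have 2 → 3 := fun h =>
      ⟨isFiniteConductor_of_lDvd_total fun M hM =>
        (exists_isLocVal_of_isSP hG h M hM).choose_spec.lDvd_total hM.isPrime,
        fun I hI => h I hI.isIdeal_wSystem⟩
    tfae_have 3 → 5 := by
      rintro ⟨hC, h⟩
      have hF : ∀ x : H, x ∉ zeroSet H → HasRadicalFactorization ((sSystem H).cl {x}) :=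
        fun x _ => h _ (isPrincipalIdeal_singleton x)
      exact radPrincipal_of_forall
        (exists_invAt_rad hF (exists_isLocVal_of_isFiniteConductor hG hC hF)) _
        fun _ => wSystem_isInvertible_iff
    tfae_have 5 → 4 := isSP_of_radPrincipalInvertible hG
    tfae_have 4 → 2 := h42
    tfae_finish
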